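/- Let $(X,d)$ be a complete separable metric space and let $E:X\to\mathbb{R}\cup\{+\infty\}$ be lower semicontinuous, with dense domain $D(E)=\{E<\infty\}$ and bounded from below on every bounded set. Assume that there is $\lambda\in\mathbb{R}$ such that from every $x\in X$ there starts an $\mathrm{EVI}_\lambda$-gradient flow of $E$, i.e. a curve $(\gamma_t)_{t>0}$, locally absolutely continuous on $(0,\infty)$, with $\gamma_t\to x$ as $t\downarrow 0$ and, for every $y\in X$, $$\tfrac12\tfrac{d}{dt}d^2(\gamma_t,y)+\tfrac{\lambda}{2}d^2(\gamma_t,y)+E(\gamma_t)\le E(y)\qquad\text{for a.e. } t>0 .$$ Let $|\partial E|$ be the slope of $E$: $|\partial E|(x)=+\infty$ if $x\notin D(E)$, $|\partial E|(x)=0$ if $x\in D(E)$ is isolated, and $|\partial E|(x)=\limsup_{y\to x}[E(x)-E(y)]^+/d(x,y)$ otherwise. Assume that there is a Hausdorff topology $\sigma$ on $X$ such that every $d$-bounded sequence has a $\sigma$-convergent subsequence, and such that $d$ (as a function on $X\times X$) and $|\partial E|$ are $\sigma$-sequentially lower semicontinuous. For $\gamma\in C([0,1],X)$ put $\mathcal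 A(\gamma)=\frac12\int_0^1|\dot\gamma_t|^2\,dt$, where $|\dot\gamma_t|$ is the metric speed and $\mathcal A(\gamma)=+\infty$ if $\gamma$ is not absolutely continuous, and $\mathcal I(\gamma)=\frac12\int_0^1|\partial E|^2(\gamma_t)\,dt$. For $\varepsilon\ge 0$ let $\mathcal A_\varepsilon=\mathcal A+\varepsilon^2\mathcal I$ (with $0\cdot\infty=0$), let $C_\varepsilon(x,y)$ be the infimum of $\mathcal A_\varepsilon(\gamma)$ over all $\gamma\in C([0,1],X)$ with $\gamma_0=x$, $\gamma_1=y$, and let $\Lambda_\varepsilon(x,y)$ be the set of $\omega\in AC^2([0,1],X)$ with $\omega_0=x$, $\omega_1=y$ and $\mathcal A_\varepsilon(\omega)=C_\varepsilon(x,y)$. Fix $x,y\in X$ such that for some $\varepsilon>0$ the infimum $C_\varepsilon(x,y)$ is finite and attained. Then $C_\varepsilon(x,y)<\infty$ for every $\varepsilon\ge0$, and the map $\varepsilon\mapsto C_\varepsilon(x,y)$ is locally absolutely continuous on $[0,\infty)$ and left and right differentiable at every point of $(0,\infty)$. For every $\varepsilon>0$ the functional $\mathcal I$ attains a (finite) maximum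 and minimum on $\Lambda_\varepsilon(x,y)$, and $$\frac{d^-}{d\varepsilon}C_\varepsilon(x,y)=2\varepsilon\max_{\Lambda_\varepsilon(x,y)}\mathcal I,\qquad \frac{d^+}{d\varepsilon}C_\varepsilon(x,y)=2\varepsilon\min_{\Lambda_\varepsilon(x,y)}\mathcal I .$$ On $(0,\infty)$ the left derivative is left-continuous and the right derivative is right-continuous. -/

import Mathlib

open Set Filter Topology MeasureTheory
open scoped ENNReal

namespace EntropicCost

section Curves

variable {X : Type*} [MetricSpace X]

/-- Absolute continuity of a curve on the compact interval `[a, b]`: there is `m ∈ L¹(a, b)` with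
`d(γ_s, γ_t) ≤ ∫_s^t m(r) dr` for all `a ≤ s ≤ t ≤ b`.  Curves are functions on `ℝ`; only their
values on the interval in question matter. -/
def IsACOn (γ : ℝ → X) (a b : ℝ) : Prop :=
  ∃ m : ℝ → ℝ, IntegrableOn m (Icc a b) ∧
    ∀ s t : ℝ, a ≤ s → s ≤ t → t ≤ b → dist (γ s) (γ t) ≤ ∫ r in s..t, m r

/-- Metric speed `|γ̇_t|`, the limit of `d(γ_s, γ_t) / |s - t|` as `s → t`.  It is written as an
upper limit to be defined everywhere; the limit exists at almost every `t` for absolutely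
continuous curves. -/
noncomputable def metricSpeed (γ : ℝ → X) (t : ℝ) : ℝ≥0∞ :=
  limsup (fun s : ℝ => edist (γ s) (γ t) / edist s t) (𝓝[≠] t)

/-- `γ ∈ AC²([0,1], X)`: absolutely continuous on `[0,1]` with square integrable metric speed. -/
def IsAC2 (γ : ℝ → X) : Prop :=
  IsACOn γ 0 1 ∧ ∫⁻ t in Ioo (0 : ℝ) 1, metricSpeed γ t ^ 2 < ⊤

/-- `γ : x ⇝ y`, i.e. `γ ∈ C([0,1], X)` with `γ_0 = x` and `γ_1 = y`. -/
def Joins (γ : ℝ → X) (x y : X) : Prop :=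
  ContinuousOn γ (Icc 0 1) ∧ γ 0 = x ∧ γ 1 = y

/-- Descending slope `|∂E|` of a functional `E : X → ℝ ∪ {+∞}`: it is `+∞` outside the domain
`{E < +∞}`, and `limsup_{y → x} [E x - E y]⁺ / d(x, y)` (which is `0` at isolated points, where the
punctured neighbourhood filter is trivial) on the domain. -/
noncomputable def slope (E : X → EReal) (x : X) : ℝ≥0∞ :=
  open Classical in
  if E x = ⊤ then ⊤
  else limsup (fun y : X => (E x - E y).toENNReal / edist x y) (𝓝[≠] x)

/-- `γ : (0, ∞) → X` is a gradient flow of `E` in the `EVI_lam` sense starting from `x`. -/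
structure IsEVIFlow (E : X → EReal) (lam : ℝ) (x : X) (γ : ℝ → X) : Prop where
  ac_loc : ∀ a b : ℝ, 0 < a → a ≤ b → IsACOn γ a b
  evi : ∀ y : X, ∀ᵐ t ∂(volume.restrict (Ioi (0 : ℝ))),
    (((1 / 2) * deriv (fun s : ℝ => dist (γ s) y ^ 2) t
        + (lam / 2) * dist (γ t) y ^ 2 : ℝ) : EReal) + E (γ t) ≤ E y
  start_mem : x ∈ closure {z : X | E z < ⊤}
  start : Tendsto γ (𝓝[>] 0) (𝓝 x)

/-- Standing hypotheses on the functional `E : X → ℝ ∪ {+∞}` (the value `-∞` of `EReal` is excluded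
by `bddBelow`). -/
structure IsAdmissibleEnergy (E : X → EReal) : Prop where
  lsc : LowerSemicontinuous E
  dense_domain : Dense {z : X | E z < ⊤}
  bddBelow : ∀ B : Set X, Bornology.IsBounded B → ∃ c : ℝ, ∀ z ∈ B, (c : EReal) ≤ E z
  flow : ∃ lam : ℝ, ∀ x : X, ∃ γ : ℝ → X, IsEVIFlow E lam x γ

/-- There is a Hausdorff topology `σ` on `X` for which `d`-bounded sets are relatively sequentially
compact, and for which the distance (jointly) and the slope are sequentially lower
semicontinuous. -/
def HasWeakTopology (E : X → EReal) : Prop :=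
  ∃ σ : TopologicalSpace X, @T2Space X σ ∧
    (∀ u : ℕ → X, Bornology.IsBounded (range u) →
      ∃ z : X, ∃ φ : ℕ → ℕ, StrictMono φ ∧ Tendsto (u ∘ φ) atTop (@nhds X σ z)) ∧
    (∀ (u v : ℕ → X) (z w : X), Tendsto u atTop (@nhds X σ z) → Tendsto v atTop (@nhds X σ w) →
      edist z w ≤ liminf (fun n => edist (u n) (v n)) atTop) ∧
    (∀ (u : ℕ → X) (z : X), Tendsto u atTop (@nhds X σ z) →
      slope E z ≤ liminf (fun n => slope E (u n)) atTop)

/-- Kinetic energy `𝒜(γ) = ½ ∫₀¹ |γ̇_t|² dt`, equal to `+∞` if `γ` is not absolutely continuous. -/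
noncomputable def kinetic (γ : ℝ → X) : ℝ≥0∞ :=
  open Classical in
  if IsACOn γ 0 1 then 2⁻¹ * ∫⁻ t in Ioo (0 : ℝ) 1, metricSpeed γ t ^ 2 else ⊤

/-- Halved Fisher information `ℐ(γ) = ½ ∫₀¹ |∂E|²(γ_t) dt`. -/
noncomputable def fisher (E : X → EReal) (γ : ℝ → X) : ℝ≥0∞ :=
  2⁻¹ * ∫⁻ t in Ioo (0 : ℝ) 1, slope E (γ t) ^ 2

/-- `𝒜_ε(γ) = 𝒜(γ) + ε² ℐ(γ)`, with `0 · ∞ = 0`. -/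
noncomputable def action (E : X → EReal) (ε : ℝ) (γ : ℝ → X) : ℝ≥0∞ :=
  kinetic γ + ENNReal.ofReal (ε ^ 2) * fisher E γ

/-- The entropic cost `C_ε(x, y)`, the infimum of `𝒜_ε` over all continuous curves `x ⇝ y`. -/
noncomputable def cost (E : X → EReal) (x y : X) (ε : ℝ) : ℝ≥0∞ :=
  ⨅ (γ : ℝ → X) (_ : Joins γ x y), action E ε γ

/-- The `ε`-Schrödinger problem between `x` and `y` is solvable: its infimum is finite and
attained. -/
def IsSolvable (E : X → EReal) (x y : X) (ε : ℝ) : Prop :=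
  ∃ γ : ℝ → X, Joins γ x y ∧ action E ε γ = cost E x y ε ∧ cost E x y ε < ⊤

/-- The set `Λ_ε(x, y)` of `ε`-minimizers. -/
def minimizers (E : X → EReal) (x y : X) (ε : ℝ) : Set (ℝ → X) :=
  {ω | IsAC2 ω ∧ ω 0 = x ∧ ω 1 = y ∧ action E ε ω = cost E x y ε}

end Curves

end EntropicCost

/-!
As a function of `s = ε²`, the cost is the infimum of the affine functions `s ↦ 𝒜(γ) + s ℐ(γ)`, over
the curves `γ` from `x` to `y` along which both functionals are finite. The set of these pairs
`(𝒜(γ), ℐ(γ))` is closed up to domination: by Arzelà–Ascoli in the topology `σ` and lower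
semicontinuity, a sequence of curves whose pairs converge has a limit curve with a smaller pair.
Hence minimisers exist and depend upper hemicontinuously on `s > 0`. Comparing the affine functions
at two values of `s` squeezes the difference quotients of the infimum between values of `ℐ` at
minimisers, which gives the one-sided derivatives and their one-sided continuity.

At `s = 0` continuity amounts to approximating the infimum of `𝒜` by curves of finite Fisher
information. The endpoints lie in `D(E)`, so following the flow of `E` along a curve for a short
time, increasing from `0` and then returning to `0`, makes `ℐ` finite and increases `𝒜` by an
arbitrarily small amount.
-/

namespace EntropicCost

section AbsoluteContinuity

variable {Y Z : Type*} [PseudoMetricSpace Y] [PseudoMetricSpace Z] {a b : ℝ}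

lemma absolutelyContinuousOnInterval_of_dist_le {f : ℝ → Y} {g : ℝ → Z}
    (hg : AbsolutelyContinuousOnInterval g a b)
    (hfg : ∀ s ∈ uIcc a b, ∀ t ∈ uIcc a b, dist (f s) (f t) ≤ dist (g s) (g t)) :
    AbsolutelyContinuousOnInterval f a b := by
  refine squeeze_zero' (Eventually.of_forall fun I => Finset.sum_nonneg fun _ _ => dist_nonneg)
    ?_ hg
  filter_upwards [mem_inf_of_right (mem_principal_self _)] with I hI
  exact Finset.sum_le_sum fun i hi => hfg _ (hI.1 i hi).1 _ (hI.1 i hi).2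

lemma absolutelyContinuousOnInterval_dist {f : ℝ → Y} (hf : AbsolutelyContinuousOnInterval f a b)
    (z : Y) : AbsolutelyContinuousOnInterval (fun t => dist (f t) z) a b :=
  absolutelyContinuousOnInterval_of_dist_le hf fun _ _ _ _ => dist_dist_dist_le_left _ _ _

lemma continuousOn_of_absolutelyContinuousOnInterval {f : ℝ → Y}
    (hf : AbsolutelyContinuousOnInterval f a b) : ContinuousOn f (uIcc a b) := by
  intro t ht
  have hdist := (absolutelyContinuousOnInterval_dist hf (f t)).continuousOn t ht
  rw [ContinuousWithinAt, dist_self] at hdist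
  exact tendsto_iff_dist_tendsto_zero.2 hdist

lemma integral_deriv_dist_eq {f : ℝ → Y} (hf : AbsolutelyContinuousOnInterval f a b) :
    ∫ r in a..b, deriv (fun r => dist (f r) (f a)) r = dist (f a) (f b) := by
  rw [(absolutelyContinuousOnInterval_dist hf (f a)).integral_deriv_eq_sub, dist_self, sub_zero,
    dist_comm]

-- The intervals `(e (p i), e (q i)]` are again disjoint, so their lengths add up to at most the
-- length of `(e a, e b]`.
lemma sum_sub_le_of_pairwiseDisjoint {ι : Type*} {e : ℝ → ℝ} (he : MonotoneOn e (Icc a b))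
    (hab : a ≤ b) (s : Finset ι) {p q : ι → ℝ}
    (hpq : ∀ i ∈ s, a ≤ p i ∧ p i ≤ q i ∧ q i ≤ b)
    (hd : (s : Set ι).PairwiseDisjoint fun i => Ioc (p i) (q i)) :
    ∑ i ∈ s, (e (q i) - e (p i)) ≤ e b - e a := by
  have hp : ∀ i ∈ s, p i ∈ Icc a b := fun i hi =>
    ⟨(hpq i hi).1, (hpq i hi).2.1.trans (hpq i hi).2.2⟩
  have hq : ∀ i ∈ s, q i ∈ Icc a b := fun i hi =>
    ⟨(hpq i hi).1.trans (hpq i hi).2.1, (hpq i hi).2.2⟩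
  have hlt : ∀ i ∈ s, ∀ j ∈ s, e (p i) < e (q j) → p i < q j := fun i hi j hj h =>
    lt_of_not_ge fun hle => h.not_ge (he (hq j hj) (hp i hi) hle)
  have himage : (s : Set ι).PairwiseDisjoint fun i => Ioc (e (p i)) (e (q i)) := by
    intro i hi j hj hij
    refine Set.disjoint_left.2 fun v hvi hvj => Set.disjoint_left.1 (hd hi hj hij)
      (show min (q i) (q j) ∈ Ioc (p i) (q i) from ⟨lt_min ?_ ?_, min_le_left _ _⟩)
      ⟨lt_min ?_ ?_, min_le_right _ _⟩
    exacts [hlt i hi i hi (hvi.1.trans_le hvi.2), hlt i hi j hj (hvi.1.trans_le hvj.2),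
      hlt j hj i hi (hvj.1.trans_le hvi.2), hlt j hj j hj (hvj.1.trans_le hvj.2)]
  have hnonneg : ∀ i ∈ s, 0 ≤ e (q i) - e (p i) := fun i hi =>
    sub_nonneg.2 (he (hp i hi) (hq i hi) (hpq i hi).2.1)
  rw [← ENNReal.ofReal_le_ofReal_iff
    (sub_nonneg.2 (he (left_mem_Icc.2 hab) (right_mem_Icc.2 hab) hab)),
    ENNReal.ofReal_sum_of_nonneg hnonneg]
  calc ∑ i ∈ s, ENNReal.ofReal (e (q i) - e (p i))
      = volume (⋃ i ∈ s, Ioc (e (p i)) (e (q i))) := by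
        simp only [measure_biUnion_finset himage fun _ _ => measurableSet_Ioc, Real.volume_Ioc]
    _ ≤ volume (Ioc (e a) (e b)) := measure_mono <| iUnion₂_subset fun i hi => Ioc_subset_Ioc
        (he (left_mem_Icc.2 hab) (hp i hi) (hp i hi).1)
        (he (hq i hi) (right_mem_Icc.2 hab) (hq i hi).2)
    _ = ENNReal.ofReal (e b - e a) := Real.volume_Ioc

end AbsoluteContinuity

section EnergyBounds

variable {X : Type*} [MetricSpace X] {γ : ℝ → X} {e : ℝ → ℝ} {a b : ℝ}

/-- The energy of `γ` on each `[s, t] ⊆ [a, b]` is at most `e t - e s`, encoded without derivatives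
as `d(γ_s, γ_t)² ≤ (t - s) (e t - e s)`.  This form passes to limits of curves, and it can be
checked on curves which are not yet known to be absolutely continuous. -/
def HasEnergyBound (γ : ℝ → X) (e : ℝ → ℝ) (a b : ℝ) : Prop :=
  ∀ s t : ℝ, a ≤ s → s ≤ t → t ≤ b → dist (γ s) (γ t) ^ 2 ≤ (t - s) * (e t - e s)

lemma HasEnergyBound.mono {c d : ℝ} (h : HasEnergyBound γ e a b) (hac : a ≤ c) (hdb : d ≤ b) :
    HasEnergyBound γ e c d :=
  fun s t hs hst ht => h s t (hac.trans hs) hst (ht.trans hdb)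

lemma HasEnergyBound.monotoneOn (h : HasEnergyBound γ e a b) : MonotoneOn e (Icc a b) := by
  intro s hs t ht hst
  rcases hst.eq_or_lt with rfl | hlt
  · exact le_rfl
  · exact sub_nonneg.1 <| nonneg_of_mul_nonneg_right
      ((sq_nonneg _).trans (h s t hs.1 hst ht.2)) (sub_pos.2 hlt)

lemma HasEnergyBound.dist_le_sqrt (h : HasEnergyBound γ e a b) {s t : ℝ} (hs : a ≤ s) (hst : s ≤ t)
    (ht : t ≤ b) : dist (γ s) (γ t) ≤ √(t - s) * √(e t - e s) := by
  rw [← Real.sqrt_mul (sub_nonneg.2 hst)]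
  exact Real.le_sqrt_of_sq_le (h s t hs hst ht)

lemma add_sq_le_of_sq_le_mul {p q τ₁ τ₂ η₁ η₂ : ℝ} (hτ₁ : 0 ≤ τ₁) (hτ₂ : 0 ≤ τ₂) (hη₁ : 0 ≤ η₁)
    (hη₂ : 0 ≤ η₂) (hp : p ^ 2 ≤ τ₁ * η₁) (hq : q ^ 2 ≤ τ₂ * η₂) :
    (p + q) ^ 2 ≤ (τ₁ + τ₂) * (η₁ + η₂) := by
  have hpq : (p * q) ^ 2 ≤ (τ₁ * η₂) * (τ₂ * η₁) := by
    calc (p * q) ^ 2 = p ^ 2 * q ^ 2 := mul_pow p q 2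
      _ ≤ (τ₁ * η₁) * (τ₂ * η₂) := by gcongr
      _ = (τ₁ * η₂) * (τ₂ * η₁) := by ring
  have hcross : 2 * (p * q) ≤ τ₁ * η₂ + τ₂ * η₁ := by
    refine (abs_le_of_sq_le_sq' ?_ (by positivity)).2
    nlinarith [sq_nonneg (τ₁ * η₂ - τ₂ * η₁)]
  linarith

lemma HasEnergyBound.union {c : ℝ} (hab : HasEnergyBound γ e a b) (hbc : HasEnergyBound γ e b c) :
    HasEnergyBound γ e a c := by
  intro s t hs hst ht
  rcases le_total t b with htb | hbt
  · exact hab s t hs hst htb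
  rcases le_total b s with hbs | hsb
  · exact hbc s t hbs hst ht
  calc dist (γ s) (γ t) ^ 2 ≤ (dist (γ s) (γ b) + dist (γ b) (γ t)) ^ 2 := by
        gcongr
        exact dist_triangle _ _ _
    _ ≤ ((b - s) + (t - b)) * ((e b - e s) + (e t - e b)) :=
        add_sq_le_of_sq_le_mul (sub_nonneg.2 hsb) (sub_nonneg.2 hbt)
          (sub_nonneg.2 (hab.monotoneOn ⟨hs, hsb⟩ ⟨hs.trans hsb, le_rfl⟩ hsb))
          (sub_nonneg.2 (hbc.monotoneOn ⟨le_rfl, hbt.trans ht⟩ ⟨hbt, ht⟩ hbt))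
          (hab s b hs hsb le_rfl) (hbc b t le_rfl hbt ht)
    _ = (t - s) * (e t - e s) := by ring

lemma HasEnergyBound.reverse {c : ℝ} (h : HasEnergyBound γ e a b) :
    HasEnergyBound (fun t => γ (c - t)) (fun t => -e (c - t)) (c - b) (c - a) := by
  intro s t hs hst ht
  have hbound := h (c - t) (c - s) (by linarith) (by linarith) (by linarith)
  rw [dist_comm]
  linarith

-- Cauchy–Schwarz: `∑ √(tᵢ - sᵢ) √(e tᵢ - e sᵢ) ≤ √(∑ (tᵢ - sᵢ)) √(e b - e a)`.
lemma HasEnergyBound.absolutelyContinuousOnInterval (hab : a ≤ b) (h : HasEnergyBound γ e a b) :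
    AbsolutelyContinuousOnInterval γ a b := by
  let length : ℕ × (ℕ → ℝ × ℝ) → ℝ := fun I => ∑ i ∈ Finset.range I.1, dist (I.2 i).1 (I.2 i).2
  have hlength : Tendsto length AbsolutelyContinuousOnInterval.totalLengthFilter (𝓝 0) :=
    tendsto_comap
  have htotal : Tendsto (fun I => √(length I) * √(e b - e a))
      (AbsolutelyContinuousOnInterval.totalLengthFilter ⊓
        𝓟 (AbsolutelyContinuousOnInterval.disjWithin a b)) (𝓝 0) := by
    simpa using (hlength.sqrt.mul_const √(e b - e a)).mono_left inf_le_left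
  refine squeeze_zero' (Eventually.of_forall fun I => Finset.sum_nonneg fun _ _ => dist_nonneg)
    ?_ htotal
  filter_upwards [mem_inf_of_right (mem_principal_self _)] with ⟨n, I⟩ hI
  simp only [AbsolutelyContinuousOnInterval.disjWithin, mem_ofPred_eq, uIcc_of_le hab] at hI
  obtain ⟨hmem, hdisj⟩ := hI
  set p : ℕ → ℝ := fun i => min (I i).1 (I i).2
  set q : ℕ → ℝ := fun i => max (I i).1 (I i).2
  have hpq : ∀ i ∈ Finset.range n, a ≤ p i ∧ p i ≤ q i ∧ q i ≤ b := fun i hi =>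
    ⟨le_min (hmem i hi).1.1 (hmem i hi).2.1, min_le_max, max_le (hmem i hi).1.2 (hmem i hi).2.2⟩
  have hdist : ∀ i ∈ Finset.range n,
      dist (γ (I i).1) (γ (I i).2) ≤ √(q i - p i) * √(e (q i) - e (p i)) := by
    intro i hi
    have hbound := h.dist_le_sqrt (hpq i hi).1 (hpq i hi).2.1 (hpq i hi).2.2
    rcases le_total (I i).1 (I i).2 with hle | hle
    · simpa only [p, q, min_eq_left hle, max_eq_right hle] using hbound
    · simpa only [p, q, min_eq_right hle, max_eq_left hle, dist_comm] using hbound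
  calc ∑ i ∈ Finset.range n, dist (γ (I i).1) (γ (I i).2)
      ≤ ∑ i ∈ Finset.range n, √(q i - p i) * √(e (q i) - e (p i)) := Finset.sum_le_sum hdist
    _ ≤ √(∑ i ∈ Finset.range n, √(q i - p i) ^ 2) *
        √(∑ i ∈ Finset.range n, √(e (q i) - e (p i)) ^ 2) := Real.sum_mul_le_sqrt_mul_sqrt _ _ _
    _ = √(∑ i ∈ Finset.range n, dist (I i).1 (I i).2) *
        √(∑ i ∈ Finset.range n, (e (q i) - e (p i))) := by
        congr 2 <;> refine Finset.sum_congr rfl fun i hi => ?_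
        · rw [Real.sq_sqrt (sub_nonneg.2 (hpq i hi).2.1), Real.dist_eq, max_sub_min_eq_abs']
        · exact Real.sq_sqrt <| sub_nonneg.2 <| h.monotoneOn
            ⟨(hpq i hi).1, (hpq i hi).2.1.trans (hpq i hi).2.2⟩
            ⟨(hpq i hi).1.trans (hpq i hi).2.1, (hpq i hi).2.2⟩ (hpq i hi).2.1
    _ ≤ √(∑ i ∈ Finset.range n, dist (I i).1 (I i).2) * √(e b - e a) := by
        gcongr
        exact sum_sub_le_of_pairwiseDisjoint h.monotoneOn hab _ hpq hdisj

lemma HasEnergyBound.continuousOn (hab : a ≤ b) (h : HasEnergyBound γ e a b) :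
    ContinuousOn γ (Icc a b) := by
  rw [← uIcc_of_le hab]
  exact continuousOn_of_absolutelyContinuousOnInterval (h.absolutelyContinuousOnInterval hab)

lemma IsACOn.mono {c d : ℝ} (h : IsACOn γ a b) (hac : a ≤ c) (hdb : d ≤ b) : IsACOn γ c d := by
  obtain ⟨m, hm, hdist⟩ := h
  exact ⟨m, hm.mono_set (Icc_subset_Icc hac hdb),
    fun s t hs hst ht => hdist s t (hac.trans hs) hst (ht.trans hdb)⟩

lemma IsACOn.absolutelyContinuousOnInterval (hab : a ≤ b) (h : IsACOn γ a b) :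
    AbsolutelyContinuousOnInterval γ a b := by
  obtain ⟨m, hm, hdist⟩ := h
  have hint : IntervalIntegrable m volume a b :=
    (intervalIntegrable_iff_integrableOn_Icc_of_le hab).2 hm
  have hint_left : ∀ t ∈ Icc a b, IntervalIntegrable m volume a t := fun t ht =>
    hint.mono_set (by rw [uIcc_of_le hab, uIcc_of_le ht.1]; exact Icc_subset_Icc_right ht.2)
  refine absolutelyContinuousOnInterval_of_dist_le
    (hint.absolutelyContinuousOnInterval_intervalIntegral left_mem_uIcc) ?_
  rw [uIcc_of_le hab]
  intro s hs t ht
  wlog hst : s ≤ t generalizing s t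
  · rw [dist_comm, dist_comm (∫ v in a..s, m v)]
    exact this t ht s hs (le_of_not_ge hst)
  · rw [dist_comm (∫ v in a..s, m v), Real.dist_eq,
      intervalIntegral.integral_interval_sub_left (hint_left t ht) (hint_left s hs)]
    exact (hdist s t hs.1 hst ht.2).trans (le_abs_self _)

lemma IsACOn.continuousOn (hab : a ≤ b) (h : IsACOn γ a b) : ContinuousOn γ (Icc a b) := by
  rw [← uIcc_of_le hab]
  exact continuousOn_of_absolutelyContinuousOnInterval (h.absolutelyContinuousOnInterval hab)

lemma metricSpeed_congr {γ' : ℝ → X} {t : ℝ} (h : γ =ᶠ[𝓝 t] γ') :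
    metricSpeed γ t = metricSpeed γ' t := by
  refine limsup_congr ((h.filter_mono nhdsWithin_le_nhds).mono fun s hs => ?_)
  rw [hs, h.self_of_nhds]

lemma enorm_deriv_dist_le_metricSpeed (γ : ℝ → X) (z : X) (t : ℝ) :
    ‖deriv (fun s => dist (γ s) z) t‖ₑ ≤ metricSpeed γ t := by
  by_cases hd : DifferentiableAt ℝ (fun s => dist (γ s) z) t
  · have hslope := (hasDerivAt_iff_tendsto_slope.1 hd.hasDerivAt).enorm
    rw [← hslope.limsup_eq]
    refine limsup_le_limsup ?_
    filter_upwards [self_mem_nhdsWithin] with s hs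
    rw [_root_.slope_def_field, edist_dist, edist_dist,
      ← ENNReal.ofReal_div_of_pos (dist_pos.2 hs), ← ofReal_norm]
    apply ENNReal.ofReal_le_ofReal
    rw [norm_div, ← dist_eq_norm, ← dist_eq_norm]
    gcongr
    exact dist_dist_dist_le_left _ _ _
  · simp [deriv_zero_of_not_differentiableAt hd]

lemma HasEnergyBound.metricSpeed_le {t e' : ℝ} (h : HasEnergyBound γ e a b) (ht : t ∈ Ioo a b)
    (he : HasDerivAt e e' t) : metricSpeed γ t ≤ ENNReal.ofReal √e' := by
  have hlim : Tendsto (fun s => ENNReal.ofReal √(_root_.slope e t s)) (𝓝[≠] t)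
      (𝓝 (ENNReal.ofReal √e')) :=
    ENNReal.tendsto_ofReal (hasDerivAt_iff_tendsto_slope.1 he).sqrt
  rw [← hlim.limsup_eq]
  refine limsup_le_limsup ?_
  filter_upwards [self_mem_nhdsWithin, nhdsWithin_le_nhds (isOpen_Ioo.mem_nhds ht)] with s hs hsI
  have hpos : 0 < dist s t := dist_pos.2 hs
  have hbound : dist (γ s) (γ t) ^ 2 ≤ (s - t) * (e s - e t) := by
    rcases le_total s t with hst | hts
    · linarith [h s t hsI.1.le hst ht.2.le]
    · rw [dist_comm]
      exact h t s ht.1.le hts hsI.2.le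
  rw [edist_dist, edist_dist, ← ENNReal.ofReal_div_of_pos hpos]
  refine ENNReal.ofReal_le_ofReal (Real.le_sqrt_of_sq_le ?_)
  have hcancel : (e s - e t) / (s - t) * (s - t) ^ 2 = (s - t) * (e s - e t) := by
    field_simp [sub_ne_zero.2 hs]
  rwa [div_pow, div_le_iff₀ (by positivity), _root_.slope_def_field, Real.dist_eq, sq_abs, hcancel]

lemma HasEnergyBound.ae_differentiableAt (h : HasEnergyBound γ e a b) :
    ∀ᵐ t, t ∈ Ioo a b → DifferentiableAt ℝ e t := by
  filter_upwards [(h.monotoneOn.mono Ioo_subset_Icc_self).ae_differentiableWithinAt_of_mem]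
    with t ht hI
  exact (ht hI).differentiableAt (isOpen_Ioo.mem_nhds hI)

lemma deriv_nonneg_of_monotoneOn_Icc (he : MonotoneOn e (Icc a b)) {t : ℝ} (ht : t ∈ Ioo a b) :
    0 ≤ deriv e t := by
  rw [← derivWithin_of_isOpen isOpen_Ioo ht]
  exact (he.mono Ioo_subset_Icc_self).derivWithin_nonneg

lemma HasEnergyBound.lintegral_metricSpeed_sq_le (hab : a ≤ b) (h : HasEnergyBound γ e a b) :
    ∫⁻ t in Ioo a b, metricSpeed γ t ^ 2 ≤ ENNReal.ofReal (e b - e a) := by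
  have hmono : MonotoneOn e (uIcc a b) := by
    rw [uIcc_of_le hab]
    exact h.monotoneOn
  have hderiv_nonneg : ∀ t ∈ Ioo a b, 0 ≤ deriv e t := fun t =>
    deriv_nonneg_of_monotoneOn_Icc h.monotoneOn
  have hintegral_le := hmono.intervalIntegral_deriv_mem_uIcc
  rw [uIcc_of_le (sub_nonneg.2 (h.monotoneOn ⟨le_rfl, hab⟩ ⟨hab, le_rfl⟩ hab))] at hintegral_le
  calc ∫⁻ t in Ioo a b, metricSpeed γ t ^ 2
      ≤ ∫⁻ t in Ioo a b, ENNReal.ofReal (deriv e t) := by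
        refine lintegral_mono_ae ((ae_restrict_iff' measurableSet_Ioo).2 ?_)
        filter_upwards [h.ae_differentiableAt] with t hdiff ht
        calc metricSpeed γ t ^ 2 ≤ ENNReal.ofReal √(deriv e t) ^ 2 := by
              gcongr
              exact h.metricSpeed_le ht (hdiff ht).hasDerivAt
          _ = ENNReal.ofReal (deriv e t) := by
              rw [← ENNReal.ofReal_pow (Real.sqrt_nonneg _), Real.sq_sqrt (hderiv_nonneg t ht)]
    _ = ENNReal.ofReal (∫ t in Ioo a b, deriv e t) :=
        (ofReal_integral_eq_lintegral_ofReal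
          ((intervalIntegrable_iff_integrableOn_Ioo_of_le hab).1 hmono.intervalIntegrable_deriv)
          ((ae_restrict_iff' measurableSet_Ioo).2 (ae_of_all _ hderiv_nonneg))).symm
    _ ≤ ENNReal.ofReal (e b - e a) := by
        rw [← integral_Ioc_eq_integral_Ioo, ← intervalIntegral.integral_of_le hab]
        exact ENNReal.ofReal_le_ofReal hintegral_le.2

lemma integrableOn_sqrt_deriv_of_monotoneOn (hab : a ≤ b) (he : MonotoneOn e (Icc a b)) :
    IntegrableOn (fun t => √(deriv e t)) (Icc a b) := by
  rw [← uIcc_of_le hab] at he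
  have hderiv := (intervalIntegrable_iff_integrableOn_Icc_of_le hab).1 he.intervalIntegrable_deriv
  refine Integrable.mono' (g := fun t => 1 + |deriv e t|) ((integrable_const _).add hderiv.abs)
    (measurable_deriv e).sqrt.aestronglyMeasurable (ae_of_all _ fun t => ?_)
  rw [Real.norm_of_nonneg (Real.sqrt_nonneg _)]
  refine Real.sqrt_le_iff.2 ⟨by positivity, ?_⟩
  nlinarith [abs_nonneg (deriv e t), le_abs_self (deriv e t), sq_nonneg (deriv e t)]

lemma HasEnergyBound.isACOn (hab : a ≤ b) (h : HasEnergyBound γ e a b) : IsACOn γ a b := by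
  have hint := integrableOn_sqrt_deriv_of_monotoneOn hab h.monotoneOn
  refine ⟨_, hint, fun s t hs hst ht => ?_⟩
  have hst_bound : HasEnergyBound γ e s t := h.mono hs ht
  have hAC := hst_bound.absolutelyContinuousOnInterval hst
  rw [← integral_deriv_dist_eq hAC]
  refine intervalIntegral.integral_mono_ae_restrict hst
    (absolutelyContinuousOnInterval_dist hAC (γ s)).intervalIntegrable_deriv
    ((intervalIntegrable_iff_integrableOn_Icc_of_le hst).2
      (hint.mono_set (Icc_subset_Icc hs ht))) ?_
  rw [← restrict_Ioo_eq_restrict_Icc]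
  refine (ae_restrict_iff' measurableSet_Ioo).2 ?_
  filter_upwards [hst_bound.ae_differentiableAt] with r hdiff hr
  have hspeed := (enorm_deriv_dist_le_metricSpeed γ (γ s) r).trans
    (hst_bound.metricSpeed_le hr (hdiff hr).hasDerivAt)
  rw [← ofReal_norm, ENNReal.ofReal_le_ofReal_iff (Real.sqrt_nonneg _)] at hspeed
  exact (Real.le_norm_self _).trans hspeed

lemma HasEnergyBound.kinetic_le (h : HasEnergyBound γ e 0 1) :
    kinetic γ ≤ ENNReal.ofReal ((e 1 - e 0) / 2) := by
  rw [kinetic, if_pos (h.isACOn zero_le_one), div_eq_inv_mul, ENNReal.ofReal_mul (by norm_num),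
    ENNReal.ofReal_inv_of_pos two_pos, ENNReal.ofReal_ofNat]
  gcongr
  exact h.lintegral_metricSpeed_sq_le zero_le_one

/-- The energy `∫_a^t |γ̇_r|² dr` of a curve on `[a, t]`, as a real number; it is `0` by convention
when the integral is infinite. -/
noncomputable def energy (γ : ℝ → X) (a t : ℝ) : ℝ :=
  (∫⁻ r in Ioo a t, metricSpeed γ r ^ 2).toReal

lemma energy_self (γ : ℝ → X) (a : ℝ) : energy γ a a = 0 := by simp [energy]

lemma toReal_lintegral_Ioo_sub {f : ℝ → ℝ≥0∞} {s t : ℝ} (has : a ≤ s) (hst : s ≤ t)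
    (hfin : ∫⁻ r in Ioo a t, f r ≠ ⊤) :
    (∫⁻ r in Ioo a t, f r).toReal - (∫⁻ r in Ioo a s, f r).toReal
      = (∫⁻ r in Ioo s t, f r).toReal := by
  have hsplit : ∫⁻ r in Ioo a t, f r = (∫⁻ r in Ioo a s, f r) + ∫⁻ r in Ioo s t, f r := by
    simp only [restrict_Ioo_eq_restrict_Ioc]
    rw [← Ioc_union_Ioc_eq_Ioc has hst,
      lintegral_union measurableSet_Ioc (Ioc_disjoint_Ioc_of_le le_rfl)]
  have hadd := hfin
  rw [hsplit, ENNReal.add_ne_top] at hadd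
  rw [hsplit, ENNReal.toReal_add hadd.1 hadd.2, add_sub_cancel_left]

lemma sq_integral_le_mul_lintegral {f : ℝ → ℝ} {s t : ℝ} (hst : s ≤ t) (hf : Measurable f)
    (hfin : ∫⁻ r in Ioo s t, ‖f r‖ₑ ^ 2 ≠ ⊤) :
    (∫ r in s..t, f r) ^ 2 ≤ (t - s) * (∫⁻ r in Ioo s t, ‖f r‖ₑ ^ 2).toReal := by
  have hHolder := ENNReal.lintegral_mul_le_Lp_mul_Lq (volume.restrict (Ioo s t))
    (p := 2) (q := 2) (Real.HolderConjugate.two_two) (f := fun _ => 1) (g := fun r => ‖f r‖ₑ)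
    aemeasurable_const hf.enorm.aemeasurable
  simp only [Pi.mul_apply, one_mul, one_pow, lintegral_const, Measure.restrict_apply,
    MeasurableSet.univ, univ_inter, Real.volume_Ioo, ENNReal.rpow_two] at hHolder
  have henorm : ENNReal.ofReal ((∫ r in s..t, f r) ^ 2)
      ≤ ENNReal.ofReal (t - s) * ∫⁻ r in Ioo s t, ‖f r‖ₑ ^ 2 := by
    rw [intervalIntegral.integral_of_le hst, integral_Ioc_eq_integral_Ioo, ← sq_abs,
      ENNReal.ofReal_pow (abs_nonneg _), ← Real.norm_eq_abs, ofReal_norm]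
    calc ‖∫ r in Ioo s t, f r‖ₑ ^ 2 ≤ (∫⁻ r in Ioo s t, ‖f r‖ₑ) ^ 2 := by
          gcongr
          exact enorm_integral_le_lintegral_enorm _
      _ ≤ (ENNReal.ofReal (t - s) ^ (1 / 2 : ℝ) *
          (∫⁻ r in Ioo s t, ‖f r‖ₑ ^ 2) ^ (1 / 2 : ℝ)) ^ 2 := by gcongr
      _ = ENNReal.ofReal (t - s) * ∫⁻ r in Ioo s t, ‖f r‖ₑ ^ 2 := by
          rw [mul_pow, ← ENNReal.rpow_two, ← ENNReal.rpow_two, ← ENNReal.rpow_mul,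
            ← ENNReal.rpow_mul]
          norm_num
  rwa [ENNReal.ofReal_le_iff_le_toReal (ENNReal.mul_ne_top ENNReal.ofReal_ne_top hfin),
    ENNReal.toReal_mul, ENNReal.toReal_ofReal (sub_nonneg.2 hst)] at henorm

lemma IsACOn.dist_sq_le_mul_energy (hab : a ≤ b) (h : IsACOn γ a b)
    (hfin : ∫⁻ t in Ioo a b, metricSpeed γ t ^ 2 ≠ ⊤) :
    dist (γ a) (γ b) ^ 2 ≤ (b - a) * energy γ a b := by
  have hle : ∫⁻ r in Ioo a b, ‖deriv (fun r => dist (γ r) (γ a)) r‖ₑ ^ 2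
      ≤ ∫⁻ r in Ioo a b, metricSpeed γ r ^ 2 :=
    lintegral_mono fun r => by
      gcongr
      exact enorm_deriv_dist_le_metricSpeed γ (γ a) r
  rw [← integral_deriv_dist_eq (h.absolutelyContinuousOnInterval hab)]
  exact (sq_integral_le_mul_lintegral hab (measurable_deriv _) (ne_top_of_le_ne_top hfin hle)).trans
    (mul_le_mul_of_nonneg_left (ENNReal.toReal_mono hfin hle) (sub_nonneg.2 hab))

lemma IsACOn.hasEnergyBound (h : IsACOn γ a b)
    (hfin : ∫⁻ t in Ioo a b, metricSpeed γ t ^ 2 ≠ ⊤) : HasEnergyBound γ (energy γ a) a b := by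
  intro s t hs hst ht
  have hfin_mono : ∀ {c d}, a ≤ c → d ≤ b → ∫⁻ r in Ioo c d, metricSpeed γ r ^ 2 ≠ ⊤ :=
    fun hc hd => ne_top_of_le_ne_top hfin (lintegral_mono_set (Ioo_subset_Ioo hc hd))
  rw [energy, energy, toReal_lintegral_Ioo_sub hs hst (hfin_mono le_rfl ht)]
  exact (h.mono hs ht).dist_sq_le_mul_energy hst (hfin_mono hs ht)

lemma kinetic_lt_top_iff : kinetic γ < ⊤ ↔ IsAC2 γ := by
  unfold kinetic IsAC2
  split_ifs with h
  · simp [h, ENNReal.mul_eq_top, lt_top_iff_ne_top]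
  · simp [h]

lemma IsAC2.hasEnergyBound (h : IsAC2 γ) : HasEnergyBound γ (energy γ 0) 0 1 :=
  h.1.hasEnergyBound h.2.ne

lemma IsAC2.energy_eq (h : IsAC2 γ) : energy γ 0 1 = 2 * (kinetic γ).toReal := by
  rw [kinetic, if_pos h.1, energy, ENNReal.toReal_mul]
  simp

end EnergyBounds

section Gronwall

lemma le_mul_exp_of_le_add_integral {ψ : ℝ → ℝ} {a b A κ : ℝ} (hψ : ContinuousOn ψ (Icc a b))
    (hψ_nonneg : ∀ t ∈ Icc a b, 0 ≤ ψ t) (hκ : 0 ≤ κ)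
    (hle : ∀ t ∈ Icc a b, ψ t ≤ A + κ * ∫ r in a..t, ψ r) {t : ℝ} (ht : t ∈ Icc a b) :
    ψ t ≤ A * Real.exp (κ * (t - a)) := by
  have hab : a ≤ b := ht.1.trans ht.2
  have hA : 0 ≤ A := by
    simpa using (hψ_nonneg a (left_mem_Icc.2 hab)).trans (hle a (left_mem_Icc.2 hab))
  have hderiv : ∀ t ∈ Ico a b,
      HasDerivWithinAt (fun t => A + κ * ∫ r in a..t, ψ r) (κ * ψ t) (Ici t) t := by
    intro t ht
    have hnhds : 𝓝[>] t ≤ 𝓝[Icc a b] t :=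
      nhdsWithin_le_of_mem (Icc_mem_nhdsGT_of_mem ht)
    exact ((intervalIntegral.integral_hasDerivWithinAt_right
      ((hψ.mono (Icc_subset_Icc_right ht.2.le)).intervalIntegrable_of_Icc ht.1)
      ((hψ.stronglyMeasurableAtFilter_nhdsWithin measurableSet_Icc t).filter_mono hnhds)
      ((hψ t (Ico_subset_Icc_self ht)).mono_left hnhds)).const_mul κ).const_add A
  have hcont : ContinuousOn (fun t => A + κ * ∫ r in a..t, ψ r) (Icc a b) := by
    rw [← uIcc_of_le hab] at hψ ⊢
    exact continuousOn_const.add (continuousOn_const.mul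
      (intervalIntegral.continuousOn_primitive_interval hψ.integrableOn_uIcc))
  have hbound := norm_le_gronwallBound_of_norm_deriv_right_le hcont hderiv (K := κ) (ε := 0)
    (by simp [abs_of_nonneg hA] : _ ≤ A) ?_ t ht
  · rw [gronwallBound_ε0] at hbound
    exact (hle t ht).trans ((le_abs_self _).trans hbound)
  · intro r hr
    rw [norm_mul, Real.norm_of_nonneg hκ, add_zero,
      Real.norm_of_nonneg (hψ_nonneg r (Ico_subset_Icc_self hr))]
    gcongr
    exact (hle r (Ico_subset_Icc_self hr)).trans (le_abs_self _)

end Gronwall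

section Flows

variable {X : Type*} [MetricSpace X] {E : X → EReal} {x y z w : X} {u γ : ℝ → X} {lam κ s t : ℝ}

lemma continuousOn_dist_sq {S : Set ℝ} (h : ContinuousOn u S) (y : X) :
    ContinuousOn (fun r => dist (u r) y ^ 2) S :=
  (continuous_dist.comp_continuousOn (h.prodMk continuousOn_const)).pow 2

lemma integral_dist_sq_le {C : ℝ} (hst : s ≤ t) (hu : ContinuousOn u (Icc s t))
    (hC : ∀ r ∈ Icc s t, dist (u r) y ^ 2 ≤ C) :
    ∫ r in s..t, dist (u r) y ^ 2 ≤ (t - s) * C := by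
  calc ∫ r in s..t, dist (u r) y ^ 2 ≤ ∫ _ in s..t, C :=
        intervalIntegral.integral_mono_on hst
          ((continuousOn_dist_sq hu y).intervalIntegrable_of_Icc hst) intervalIntegrable_const hC
    _ = (t - s) * C := by simp

lemma eq_of_dist_sq_le_integral (hst : s ≤ t) (hκ : 0 ≤ κ) (hu : ContinuousOn u (Icc s t))
    (hle : ∀ r ∈ Icc s t, dist (u r) (u s) ^ 2 ≤ κ * ∫ q in s..r, dist (u q) (u s) ^ 2) :
    u t = u s := by
  have hzero := le_mul_exp_of_le_add_integral (A := 0) (continuousOn_dist_sq hu (u s))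
    (fun _ _ => sq_nonneg _) hκ (by simpa only [zero_add] using hle) (right_mem_Icc.2 hst)
  rw [zero_mul, sq_nonpos_iff] at hzero
  exact dist_eq_zero.1 hzero

lemma IsAdmissibleEnergy.ne_bot (hE : IsAdmissibleEnergy E) (z : X) : E z ≠ ⊥ := by
  obtain ⟨c, hc⟩ := hE.bddBelow {z} Bornology.isBounded_singleton
  exact ((EReal.bot_lt_coe c).trans_le (hc z rfl)).ne'

lemma IsAdmissibleEnergy.coe_toReal (hE : IsAdmissibleEnergy E) (hz : E z < ⊤) :
    ((E z).toReal : EReal) = E z :=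
  EReal.coe_toReal hz.ne (hE.ne_bot z)

lemma IsAdmissibleEnergy.toReal_le (hE : IsAdmissibleEnergy E) (hw : E w < ⊤) (h : E z ≤ E w) :
    (E z).toReal ≤ (E w).toReal :=
  EReal.toReal_le_toReal h (hE.ne_bot z) hw.ne

lemma IsAdmissibleEnergy.exists_le_toReal (hE : IsAdmissibleEnergy E) {B : Set X}
    (hB : Bornology.IsBounded B) : ∃ c : ℝ, ∀ z ∈ B, E z < ⊤ → c ≤ (E z).toReal := by
  obtain ⟨c, hc⟩ := hE.bddBelow B hB
  refine ⟨c, fun z hz hfin => ?_⟩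
  rw [← EReal.coe_le_coe_iff, hE.coe_toReal hfin]
  exact hc z hz

lemma IsEVIFlow.continuousOn (h : IsEVIFlow E lam x γ) : ContinuousOn γ (Ioi 0) := by
  intro t (ht : 0 < t)
  have hcont := (h.ac_loc (t / 2) (t + 1) (by linarith) (by linarith)).continuousOn (by linarith)
  exact (hcont.continuousAt (Icc_mem_nhds (by linarith) (by linarith))).continuousWithinAt

lemma IsEVIFlow.continuousOn_Icc (h : IsEVIFlow E lam x γ) (hs : 0 < s) :
    ContinuousOn γ (Icc s t) :=
  h.continuousOn.mono fun _ hr => hs.trans_le hr.1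

lemma IsEVIFlow.absolutelyContinuousOnInterval_dist_sq (h : IsEVIFlow E lam x γ) (hs : 0 < s)
    (hst : s ≤ t) (y : X) : AbsolutelyContinuousOnInterval (fun r => dist (γ r) y ^ 2) s t := by
  have hdist := absolutelyContinuousOnInterval_dist
    ((h.ac_loc s t hs hst).absolutelyContinuousOnInterval hst) y
  simpa only [sq] using hdist.fun_mul hdist

lemma IsEVIFlow.ae_le (hE : IsAdmissibleEnergy E) (h : IsEVIFlow E lam x γ) (hy : E y < ⊤) :
    ∀ᵐ t, 0 < t → E (γ t) < ⊤ ∧ 1 / 2 * deriv (fun s => dist (γ s) y ^ 2) t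
      + lam / 2 * dist (γ t) y ^ 2 + (E (γ t)).toReal ≤ (E y).toReal := by
  filter_upwards [(ae_restrict_iff' measurableSet_Ioi).1 (h.evi y)] with t ht hpos
  have hevi := ht hpos
  have hfin : E (γ t) < ⊤ := by
    by_contra htop
    rw [not_lt, top_le_iff] at htop
    rw [htop, EReal.coe_add_top, top_le_iff] at hevi
    exact hy.ne hevi
  refine ⟨hfin, ?_⟩
  rw [← hE.coe_toReal hfin, ← hE.coe_toReal hy] at hevi
  exact_mod_cast hevi

lemma IsEVIFlow.intervalIntegrable (hE : IsAdmissibleEnergy E) (h : IsEVIFlow E lam x γ)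
    (hs : 0 < s) (hst : s ≤ t) :
    IntervalIntegrable (fun r => (E (γ r)).toReal) volume s t := by
  obtain ⟨y, hy⟩ := hE.dense_domain.nonempty_iff.2 ⟨x⟩
  have hcont : ContinuousOn γ (Icc s t) := h.continuousOn_Icc hs
  obtain ⟨c, hc⟩ := hE.exists_le_toReal (isCompact_Icc.image_of_continuousOn hcont).isBounded
  have hderiv := (intervalIntegrable_iff_integrableOn_Icc_of_le hst).1
    (h.absolutelyContinuousOnInterval_dist_sq hs hst y).intervalIntegrable_deriv
  have hdist : IntegrableOn (fun r => dist (γ r) y ^ 2) (Icc s t) :=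
    (continuousOn_dist_sq hcont y).integrableOn_Icc
  rw [intervalIntegrable_iff_integrableOn_Icc_of_le hst]
  borelize X
  have hmeas : AEStronglyMeasurable (fun r => (E (γ r)).toReal) (volume.restrict (Icc s t)) :=
    ((measurable_ereal_toReal.comp hE.lsc.measurable).comp_aemeasurable
      (hcont.aemeasurable measurableSet_Icc)).aestronglyMeasurable
  refine integrable_of_le_of_le hmeas
    ((ae_restrict_iff' measurableSet_Icc).2 ?_) ((ae_restrict_iff' measurableSet_Icc).2 ?_)
    (integrable_const c)
    (((integrable_const (E y).toReal).sub (hderiv.const_mul (1 / 2))).sub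
      (hdist.const_mul (lam / 2)))
  · filter_upwards [h.ae_le hE hy] with r hr hI
    exact hc _ (mem_image_of_mem γ hI) (hr (hs.trans_le hI.1)).1
  · filter_upwards [h.ae_le hE hy] with r hr hI
    simp only [Pi.sub_apply]
    linarith [(hr (hs.trans_le hI.1)).2]

lemma IsEVIFlow.dist_sq_add_integral_le (hE : IsAdmissibleEnergy E) (h : IsEVIFlow E lam x γ)
    (hκ : -lam ≤ κ) (hy : E y < ⊤) (hs : 0 < s) (hst : s ≤ t) :
    dist (γ t) y ^ 2 / 2 + ∫ r in s..t, (E (γ r)).toReal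
      ≤ dist (γ s) y ^ 2 / 2 + (t - s) * (E y).toReal + κ / 2 * ∫ r in s..t, dist (γ r) y ^ 2 := by
  have hAC := h.absolutelyContinuousOnInterval_dist_sq hs hst y
  have hderiv := hAC.intervalIntegrable_deriv
  have hdist : IntervalIntegrable (fun r => dist (γ r) y ^ 2) volume s t :=
    (continuousOn_dist_sq (h.continuousOn_Icc hs) y).intervalIntegrable_of_Icc hst
  have henergy := h.intervalIntegrable hE hs hst
  have hle : ∫ r in s..t, (1 / 2 * deriv (fun s => dist (γ s) y ^ 2) r + (E (γ r)).toReal)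
      ≤ ∫ r in s..t, ((E y).toReal + κ / 2 * dist (γ r) y ^ 2) := by
    refine intervalIntegral.integral_mono_ae_restrict hst ((hderiv.const_mul _).add henergy)
      (intervalIntegrable_const.add (hdist.const_mul _)) ?_
    refine (ae_restrict_iff' measurableSet_Icc).2 ?_
    filter_upwards [h.ae_le hE hy] with r hr hI
    have hlam : -lam * dist (γ r) y ^ 2 ≤ κ * dist (γ r) y ^ 2 := by gcongr
    linarith [(hr (hs.trans_le hI.1)).2]
  rw [intervalIntegral.integral_add (hderiv.const_mul _) henergy,
    intervalIntegral.integral_add intervalIntegrable_const (hdist.const_mul _),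
    intervalIntegral.integral_const_mul, intervalIntegral.integral_const_mul,
    hAC.integral_deriv_eq_sub, intervalIntegral.integral_const, smul_eq_mul] at hle
  linarith

lemma IsEVIFlow.dist_sq_add_le_of_forall_le (hE : IsAdmissibleEnergy E) (h : IsEVIFlow E lam x γ)
    (hκ : -lam ≤ κ) (hy : E y < ⊤) (hs : 0 < s) (hst : s ≤ t) (hz : E z < ⊤)
    (hle : ∀ r ∈ Ioo s t, E z ≤ E (γ r)) :
    dist (γ t) y ^ 2 / 2 + (t - s) * (E z).toReal
      ≤ dist (γ s) y ^ 2 / 2 + (t - s) * (E y).toReal + κ / 2 * ∫ r in s..t, dist (γ r) y ^ 2 := by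
  have henergy : (t - s) * (E z).toReal ≤ ∫ r in s..t, (E (γ r)).toReal := by
    calc (t - s) * (E z).toReal = ∫ _ in s..t, (E z).toReal := by simp
      _ ≤ ∫ r in s..t, (E (γ r)).toReal := by
        refine intervalIntegral.integral_mono_ae_restrict hst intervalIntegrable_const
          (h.intervalIntegrable hE hs hst) ?_
        rw [← restrict_Ioo_eq_restrict_Icc]
        refine (ae_restrict_iff' measurableSet_Ioo).2 ?_
        filter_upwards [h.ae_le hE hz] with r hr hI
        exact hE.toReal_le (hr (hs.trans hI.1)).1 (hle r hI)
  linarith [h.dist_sq_add_integral_le hE hκ hy hs hst]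

lemma IsEVIFlow.eq_of_forall_le (hE : IsAdmissibleEnergy E) (h : IsEVIFlow E lam x γ) (hs : 0 < s)
    (hst : s ≤ t) (hfin : E (γ s) < ⊤) (hle : ∀ r ∈ Ioo s t, E (γ s) ≤ E (γ r)) : γ t = γ s := by
  refine eq_of_dist_sq_le_integral hst (abs_nonneg lam) (h.continuousOn_Icc hs) fun r hr => ?_
  have hevi := h.dist_sq_add_le_of_forall_le hE (neg_le_abs lam) hfin hs hr.1 hfin
    fun q hq => hle q ⟨hq.1, hq.2.trans_le hr.2⟩
  rw [dist_self] at hevi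
  linarith

-- Otherwise `E ∘ γ` exceeds `E (γ s)` on all of `(s', t]`, where `s'` is the last time in `[s, t]`
-- with `E (γ s') ≤ E (γ s)`, and then `γ` would be constant on `[s', t]`.
lemma IsEVIFlow.antitone (hE : IsAdmissibleEnergy E) (h : IsEVIFlow E lam x γ) (hs : 0 < s)
    (hst : s ≤ t) : E (γ t) ≤ E (γ s) := by
  by_contra! hlt
  have hclosed : IsClosed (Icc s t ∩ γ ⁻¹' (E ⁻¹' Iic (E (γ s)))) :=
    (h.continuousOn_Icc hs).preimage_isClosed_of_isClosed isClosed_Icc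
      (hE.lsc.isClosed_preimage _)
  obtain ⟨s', ⟨hs', hEs'⟩, hlast⟩ := (isCompact_Icc.of_isClosed_subset hclosed
    inter_subset_left).exists_isGreatest ⟨s, ⟨le_rfl, hst⟩, le_refl (E (γ s))⟩
  have hEs' : E (γ s') ≤ E (γ s) := hEs'
  have habove : ∀ r ∈ Ioo s' t, E (γ s') ≤ E (γ r) := by
    intro r hr
    by_contra! hrs'
    exact hr.1.not_ge (hlast ⟨⟨hs'.1.trans hr.1.le, hr.2.le⟩, hrs'.le.trans hEs'⟩)
  have hconst : γ t = γ s' := h.eq_of_forall_le hE (hs.trans_le hs'.1) hs'.2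
    (hEs'.trans_lt (hlt.trans_le le_top)) habove
  exact hlt.not_ge (hconst ▸ hEs')

lemma IsEVIFlow.lt_top (hE : IsAdmissibleEnergy E) (h : IsEVIFlow E lam x γ) (ht : 0 < t) :
    E (γ t) < ⊤ := by
  obtain ⟨y, hy⟩ := hE.dense_domain.nonempty_iff.2 ⟨x⟩
  have hae : ∀ᵐ r ∂volume.restrict (Ioo 0 t), E (γ r) < ⊤ := by
    refine (ae_restrict_iff' measurableSet_Ioo).2 ?_
    filter_upwards [h.ae_le hE hy] with r hr hI using (hr hI.1).1
  have hne : NeZero (volume.restrict (Ioo 0 t)) := ⟨by simp [ht]⟩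
  obtain ⟨r, hr, hI⟩ := (hae.and (ae_restrict_mem measurableSet_Ioo)).exists
  exact (h.antitone hE hI.1 hI.2.le).trans_lt hr

lemma IsEVIFlow.dist_sq_add_le (hE : IsAdmissibleEnergy E) (h : IsEVIFlow E lam x γ)
    (hκ : -lam ≤ κ) (hy : E y < ⊤) (hs : 0 < s) (hst : s ≤ t) :
    dist (γ t) y ^ 2 / 2 + (t - s) * (E (γ t)).toReal
      ≤ dist (γ s) y ^ 2 / 2 + (t - s) * (E y).toReal + κ / 2 * ∫ r in s..t, dist (γ r) y ^ 2 :=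
  h.dist_sq_add_le_of_forall_le hE hκ hy hs hst (h.lt_top hE (hs.trans_le hst))
    fun _ hr => h.antitone hE (hs.trans hr.1) hr.2.le

/-- Curves `u : [0, ∞) → X` along which `E` is nonincreasing, and finite at positive times, and
which satisfy the evolution variational inequality in integrated form, with `E (u r)` bounded below
by `E (u t)` on `[s, t]`. -/
structure IsDescentCurve (E : X → EReal) (κ : ℝ) (u : ℝ → X) : Prop where
  nonneg : 0 ≤ κ
  continuousOn : ContinuousOn u (Ici 0)
  lt_top : ∀ t, 0 < t → E (u t) < ⊤
  antitoneOn : AntitoneOn (fun t => E (u t)) (Ici 0)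
  dist_sq_add_le : ∀ y, E y < ⊤ → ∀ s t, 0 ≤ s → s ≤ t → 0 < t →
    dist (u t) y ^ 2 / 2 + (t - s) * (E (u t)).toReal
      ≤ dist (u s) y ^ 2 / 2 + (t - s) * (E y).toReal + κ / 2 * ∫ r in s..t, dist (u r) y ^ 2

lemma IsEVIFlow.continuousOn_update (h : IsEVIFlow E lam x γ) :
    ContinuousOn (Function.update γ 0 x) (Ici 0) := by
  intro t ht
  rcases (mem_Ici.1 ht).eq_or_lt with rfl | hpos
  · rw [continuousWithinAt_update_same, Ici_sdiff_left]
    exact h.start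
  · exact (continuousWithinAt_update_of_ne hpos.ne').2
      (h.continuousOn.continuousAt (Ioi_mem_nhds hpos)).continuousWithinAt

lemma IsEVIFlow.dist_sq_add_le_start (hE : IsAdmissibleEnergy E) (h : IsEVIFlow E lam x γ)
    (hκ : -lam ≤ κ) (hκ_nonneg : 0 ≤ κ) (hy : E y < ⊤) (ht : 0 < t) :
    dist (γ t) y ^ 2 / 2 + t * (E (γ t)).toReal
      ≤ dist x y ^ 2 / 2 + t * (E y).toReal + κ / 2 * ∫ r in (0 : ℝ)..t, dist (γ r) y ^ 2 := by
  have hleft : Tendsto (fun s => dist (γ t) y ^ 2 / 2 + (t - s) * (E (γ t)).toReal) (𝓝[>] 0)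
      (𝓝 (dist (γ t) y ^ 2 / 2 + (t - 0) * (E (γ t)).toReal)) :=
    (Continuous.tendsto (by fun_prop) _).mono_left nhdsWithin_le_nhds
  have hlinear : Tendsto (fun s : ℝ => (t - s) * (E y).toReal) (𝓝[>] 0)
      (𝓝 ((t - 0) * (E y).toReal)) :=
    (Continuous.tendsto (by fun_prop) _).mono_left nhdsWithin_le_nhds
  have hright : Tendsto (fun s => dist (γ s) y ^ 2 / 2 + (t - s) * (E y).toReal
      + κ / 2 * ∫ r in (0 : ℝ)..t, dist (γ r) y ^ 2) (𝓝[>] 0)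
      (𝓝 (dist x y ^ 2 / 2 + (t - 0) * (E y).toReal
      + κ / 2 * ∫ r in (0 : ℝ)..t, dist (γ r) y ^ 2)) :=
    ((((h.start.dist tendsto_const_nhds).pow 2).div_const 2).add hlinear).add_const _
  rw [sub_zero] at hleft hright
  refine le_of_tendsto_of_tendsto hleft hright ?_
  have hint : IntervalIntegrable (fun r => dist (γ r) y ^ 2) volume 0 t := by
    refine ((continuousOn_dist_sq (h.continuousOn_update.mono Icc_subset_Ici_self)
      y).intervalIntegrable_of_Icc ht.le).congr fun r hr => ?_
    rw [uIoc_of_le ht.le] at hr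
    simp only [Function.update_of_ne hr.1.ne']
  filter_upwards [Ioo_mem_nhdsGT ht] with s hs
  refine (h.dist_sq_add_le hE hκ hy hs.1 hs.2.le).trans ?_
  gcongr
  exact intervalIntegral.integral_mono_interval hs.1.le hs.2.le le_rfl
    (ae_of_all _ fun _ => sq_nonneg _) hint

lemma IsEVIFlow.le_start (hE : IsAdmissibleEnergy E) (h : IsEVIFlow E lam x γ) (ht : 0 < t) :
    E (γ t) ≤ E x := by
  by_contra! hlt
  have hfin : E x < ⊤ := hlt.trans_le le_top
  set u := Function.update γ 0 x
  have hu_zero : u 0 = x := Function.update_self _ _ _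
  have hu_pos : ∀ r, 0 < r → u r = γ r := fun r hr => Function.update_of_ne hr.ne' _ _
  have hconst : u t = u 0 := by
    refine eq_of_dist_sq_le_integral ht.le (abs_nonneg lam)
      (h.continuousOn_update.mono Icc_subset_Ici_self) fun r hr => ?_
    rcases hr.1.eq_or_lt with rfl | hr_pos
    · simp
    have hintegral : ∫ q in (0 : ℝ)..r, dist (u q) x ^ 2 = ∫ q in (0 : ℝ)..r, dist (γ q) x ^ 2 :=
      intervalIntegral.integral_congr_uIoo fun q hq => by
        rw [uIoo_of_le hr.1] at hq
        simp only [hu_pos q hq.1]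
    have henergy : r * (E x).toReal ≤ r * (E (γ r)).toReal := by
      gcongr
      exact hE.toReal_le (h.lt_top hE hr_pos) (hlt.le.trans (h.antitone hE hr_pos hr.2))
    have hevi := h.dist_sq_add_le_start hE (neg_le_abs lam) (abs_nonneg lam) hfin hr_pos
    rw [dist_self] at hevi
    rw [hu_zero, hintegral, hu_pos r hr_pos]
    linarith
  rw [hu_zero, hu_pos t ht] at hconst
  exact hlt.ne' (congrArg E hconst)

lemma IsEVIFlow.isDescentCurve_update (hE : IsAdmissibleEnergy E) (h : IsEVIFlow E lam x γ) :
    IsDescentCurve E |lam| (Function.update γ 0 x) where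
  nonneg := abs_nonneg lam
  continuousOn := h.continuousOn_update
  lt_top t ht := by
    rw [Function.update_of_ne ht.ne']
    exact h.lt_top hE ht
  antitoneOn := by
    intro s hs t ht hst
    rcases (mem_Ici.1 hs).eq_or_lt with rfl | hs_pos
    · rcases hst.eq_or_lt with rfl | ht_pos
      · exact le_rfl
      · simpa only [Function.update_self, Function.update_of_ne ht_pos.ne'] using
          h.le_start hE ht_pos
    · simpa only [Function.update_of_ne hs_pos.ne', Function.update_of_ne (hs_pos.trans_le hst).ne']
        using h.antitone hE hs_pos hst
  dist_sq_add_le y hy s t hs hst ht := by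
    have hintegral : ∫ r in s..t, dist (Function.update γ 0 x r) y ^ 2
        = ∫ r in s..t, dist (γ r) y ^ 2 :=
      intervalIntegral.integral_congr_uIoo fun r hr => by
        rw [uIoo_of_le hst] at hr
        simp only [Function.update_of_ne (hs.trans_lt hr.1).ne']
    rw [hintegral, Function.update_of_ne ht.ne']
    rcases hs.eq_or_lt with rfl | hs_pos
    · rw [Function.update_self, sub_zero]
      exact h.dist_sq_add_le_start hE (neg_le_abs lam) (abs_nonneg lam) hy ht
    · rw [Function.update_of_ne hs_pos.ne']
      exact h.dist_sq_add_le hE (neg_le_abs lam) hy hs_pos hst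

end Flows

section Descent

variable {X : Type*} [MetricSpace X] {E : X → EReal} {κ : ℝ} {u v : ℝ → X} {y z : X} {s t τ : ℝ}

lemma IsDescentCurve.toReal_anti (hE : IsAdmissibleEnergy E) (h : IsDescentCurve E κ u)
    (hs : 0 ≤ s) (hst : s ≤ t) (hfin : E (u s) < ⊤) : (E (u t)).toReal ≤ (E (u s)).toReal :=
  hE.toReal_le hfin (h.antitoneOn hs (hs.trans hst) hst)

lemma IsDescentCurve.continuousOn_Icc (h : IsDescentCurve E κ u) (hs : 0 ≤ s) :
    ContinuousOn u (Icc s t) :=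
  h.continuousOn.mono fun _ hr => hs.trans hr.1

lemma IsDescentCurve.tendsto_nhdsGE (h : IsDescentCurve E κ u) (hs : 0 ≤ s) :
    Tendsto u (𝓝[≥] s) (𝓝 (u s)) :=
  (h.continuousOn s hs).mono fun _ hr => hs.trans hr

lemma IsDescentCurve.tendsto_nhdsGT (h : IsDescentCurve E κ u) (hs : 0 ≤ s) :
    Tendsto u (𝓝[>] s) (𝓝 (u s)) :=
  (h.tendsto_nhdsGE hs).mono_left (nhdsWithin_mono _ Ioi_subset_Ici_self)

lemma IsDescentCurve.dist_sq_le (hE : IsAdmissibleEnergy E) (h : IsDescentCurve E κ u)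
    (hs : 0 ≤ s) (hst : s ≤ t) (hfin : E (u s) < ⊤) (hsmall : κ * (t - s) ≤ 1 / 2) :
    dist (u s) (u t) ^ 2 ≤ 4 * (t - s) * ((E (u s)).toReal - (E (u t)).toReal) := by
  set drop := (E (u s)).toReal - (E (u t)).toReal
  have hdrop : 0 ≤ drop := sub_nonneg.2 (h.toReal_anti hE hs hst hfin)
  have hexp : Real.exp (κ * (t - s)) ≤ 2 :=
    (Real.exp_le_exp.2 (hsmall.trans (by linarith [Real.log_two_gt_d9]))).trans_eq
      (Real.exp_log two_pos)
  calc dist (u s) (u t) ^ 2 = dist (u t) (u s) ^ 2 := by rw [dist_comm]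
    _ ≤ 2 * (t - s) * drop * Real.exp (κ * (t - s)) := by
        refine le_mul_exp_of_le_add_integral (ψ := fun r => dist (u r) (u s) ^ 2) (b := t)
          (continuousOn_dist_sq (h.continuousOn_Icc hs) _) (fun _ _ => sq_nonneg _) h.nonneg
          (fun r hr => ?_) ⟨hst, le_rfl⟩
        have hnonneg : 0 ≤ 2 * (t - s) * drop :=
          mul_nonneg (mul_nonneg zero_le_two (sub_nonneg.2 hst)) hdrop
        rcases hr.1.eq_or_lt with rfl | hlt
        · simpa using hnonneg
        have hevi := h.dist_sq_add_le (u s) hfin s r hs hr.1 (hs.trans_lt hlt)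
        rw [dist_self] at hevi
        have hEr := h.toReal_anti hE (hs.trans hr.1) hr.2
          (h.lt_top r (hs.trans_lt hlt))
        have hmono : (r - s) * ((E (u s)).toReal - (E (u r)).toReal) ≤ (t - s) * drop :=
          mul_le_mul (by linarith [hr.2]) (by linarith)
            (sub_nonneg.2 (h.toReal_anti hE hs hr.1 hfin)) (sub_nonneg.2 hst)
        linarith
    _ ≤ 2 * (t - s) * drop * 2 := by
        have := sub_nonneg.2 hst
        gcongr
    _ = 4 * (t - s) * drop := by ring

lemma IsAdmissibleEnergy.eventually_lt_toReal (hE : IsAdmissibleEnergy E) {c : ℝ}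
    (hz : E z < ⊤) (hc : c < (E z).toReal) : ∀ᶠ w in 𝓝 z, E w < ⊤ → c < (E w).toReal := by
  have hcz : (c : EReal) < E z := by
    rw [← hE.coe_toReal hz]
    exact_mod_cast hc
  filter_upwards [hE.lsc z _ hcz] with w hw hfin
  rw [← hE.coe_toReal hfin] at hw
  exact_mod_cast hw

lemma eventually_forall_Icc {p : ℝ → Prop} (h : ∀ᶠ r in 𝓝[≥] s, p r) :
    ∀ᶠ t in 𝓝[>] s, ∀ r ∈ Icc s t, p r := by
  obtain ⟨b, hb, hsub⟩ := mem_nhdsGE_iff_exists_Ico_subset.1 h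
  filter_upwards [Ioo_mem_nhdsGT hb] with t ht r hr
  exact hsub ⟨hr.1, hr.2.trans_lt ht.2⟩

lemma IsDescentCurve.toReal_le_of_dist_le (h : IsDescentCurve E κ u) {K ρ : ℝ} (hs : 0 ≤ s)
    (hst : s < t) (hK : 0 ≤ K) (hdist : dist (u s) (u t) ≤ K * (t - s)) (hy : E y < ⊤)
    (hρ : ∀ r ∈ Icc s t, dist (u r) y ≤ ρ) :
    (E (u t)).toReal ≤ (E y).toReal + K * ρ + κ / 2 * ρ ^ 2 := by
  have hst_pos : 0 < t - s := sub_pos.2 hst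
  have hintegral : ∫ r in s..t, dist (u r) y ^ 2 ≤ (t - s) * ρ ^ 2 :=
    integral_dist_sq_le hst.le (h.continuousOn_Icc hs) fun r hr => by
      gcongr
      exact hρ r hr
  have hsq : dist (u s) y ^ 2 / 2 - dist (u t) y ^ 2 / 2 ≤ (t - s) * (K * ρ) := by
    calc dist (u s) y ^ 2 / 2 - dist (u t) y ^ 2 / 2
        = (dist (u s) y - dist (u t) y) * (dist (u s) y + dist (u t) y) / 2 := by ring
      _ ≤ (K * (t - s)) * (ρ + ρ) / 2 := by
          have := hρ s ⟨le_rfl, hst.le⟩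
          have := hρ t ⟨hst.le, le_rfl⟩
          gcongr
          linarith [dist_triangle (u s) (u t) y]
      _ = (t - s) * (K * ρ) := by ring
  have hκ : κ / 2 * ∫ r in s..t, dist (u r) y ^ 2 ≤ κ / 2 * ((t - s) * ρ ^ 2) :=
    mul_le_mul_of_nonneg_left hintegral (div_nonneg h.nonneg zero_le_two)
  refine le_of_mul_le_mul_left ?_ hst_pos
  linarith [h.dist_sq_add_le y hy s t hs hst.le (hs.trans_lt hst)]

lemma IsDescentCurve.toReal_le_of_frequently (hE : IsAdmissibleEnergy E) (h : IsDescentCurve E κ u)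
    {K : ℝ} (hs : 0 ≤ s) (hfin : E (u s) < ⊤) (hK : 0 ≤ K)
    (hfreq : ∃ᶠ t in 𝓝[>] s, dist (u s) (u t) ≤ K * (t - s)) (hy : E y < ⊤) :
    (E (u s)).toReal ≤ (E y).toReal + K * dist (u s) y + κ / 2 * dist (u s) y ^ 2 := by
  have hlim : Tendsto (fun η : ℝ => (E y).toReal + K * (dist (u s) y + η)
      + κ / 2 * (dist (u s) y + η) ^ 2 + η) (𝓝[>] 0)
      (𝓝 ((E y).toReal + K * (dist (u s) y + 0) + κ / 2 * (dist (u s) y + 0) ^ 2 + 0)) :=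
    (Continuous.tendsto (by fun_prop) _).mono_left nhdsWithin_le_nhds
  simp only [add_zero] at hlim
  refine ge_of_tendsto hlim ?_
  filter_upwards [self_mem_nhdsWithin] with η (hη : 0 < η)
  have hclose : ∀ᶠ r in 𝓝[≥] s, dist (u r) y < dist (u s) y + η :=
    ((h.tendsto_nhdsGE hs).dist tendsto_const_nhds).eventually
      (gt_mem_nhds (lt_add_of_pos_right _ hη))
  have hlsc : ∀ᶠ t in 𝓝[>] s, E (u t) < ⊤ → (E (u s)).toReal - η < (E (u t)).toReal :=
    (h.tendsto_nhdsGT hs).eventually (hE.eventually_lt_toReal hfin (sub_lt_self _ hη))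
  obtain ⟨t, ⟨hdist, hnear, hEt⟩, hst⟩ := ((hfreq.and_eventually
    ((eventually_forall_Icc hclose).and hlsc)).and_eventually self_mem_nhdsWithin).exists
  linarith [hEt (h.lt_top t (hs.trans_lt hst)),
    h.toReal_le_of_dist_le hs hst hK hdist hy fun r hr => (hnear r hr).le]

lemma IsAdmissibleEnergy.toENNReal_sub_div_edist_le_iff (hE : IsAdmissibleEnergy E) {L : ℝ}
    (hz : E z < ⊤) (hy : E y < ⊤) (hzy : z ≠ y) (hL : 0 ≤ L) :
    (E z - E y).toENNReal / edist z y ≤ ENNReal.ofReal L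
      ↔ (E z).toReal - (E y).toReal ≤ L * dist z y := by
  rw [ENNReal.div_le_iff (edist_pos.2 hzy).ne' (edist_ne_top _ _), edist_dist,
    ← ENNReal.ofReal_mul hL, ← hE.coe_toReal hz, ← hE.coe_toReal hy, ← EReal.coe_sub,
    EReal.toENNReal_of_ne_top (EReal.coe_ne_top _)]
  simp only [EReal.toReal_coe]
  exact ENNReal.ofReal_le_ofReal_iff (by positivity)

lemma slope_le_of_forall_toReal_le (hE : IsAdmissibleEnergy E) {K : ℝ} (hκ : 0 ≤ κ) (hK : 0 ≤ K)
    (hz : E z < ⊤)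
    (hle : ∀ y, E y < ⊤ → (E z).toReal ≤ (E y).toReal + K * dist z y + κ / 2 * dist z y ^ 2) :
    slope E z ≤ ENNReal.ofReal K := by
  rw [slope, if_neg hz.ne]
  rcases (𝓝[≠] z).eq_or_neBot with hbot | hne
  · simp [hbot]
  have hlim : Tendsto (fun y => ENNReal.ofReal (K + κ / 2 * dist z y)) (𝓝[≠] z)
      (𝓝 (ENNReal.ofReal (K + κ / 2 * dist z z))) :=
    ENNReal.tendsto_ofReal ((Continuous.tendsto (by fun_prop) _).mono_left nhdsWithin_le_nhds)
  rw [dist_self, mul_zero, add_zero] at hlim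
  rw [← hlim.limsup_eq]
  refine limsup_le_limsup ?_
  filter_upwards [self_mem_nhdsWithin] with y hy
  by_cases hy_top : E y = ⊤
  · simp [hy_top, EReal.sub_top]
  have hy_fin : E y < ⊤ := lt_top_iff_ne_top.2 hy_top
  rw [hE.toENNReal_sub_div_edist_le_iff hz hy_fin (Ne.symm hy) (by positivity)]
  linarith [hle y hy_fin]

lemma IsDescentCurve.slope_le_of_frequently (hE : IsAdmissibleEnergy E)
    (h : IsDescentCurve E κ u) {K : ℝ} (hs : 0 ≤ s) (hfin : E (u s) < ⊤) (hK : 0 ≤ K)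
    (hfreq : ∃ᶠ t in 𝓝[>] s, dist (u s) (u t) ≤ K * (t - s)) :
    slope E (u s) ≤ ENNReal.ofReal K :=
  slope_le_of_forall_toReal_le hE h.nonneg hK hfin fun _ hy =>
    h.toReal_le_of_frequently hE hs hfin hK hfreq hy

lemma IsDescentCurve.slope_le_metricSpeed (hE : IsAdmissibleEnergy E)
    (h : IsDescentCurve E κ u) (hs : 0 < s) : slope E (u s) ≤ metricSpeed u s := by
  refine le_of_forall_gt_imp_ge_of_dense fun L hL => ?_
  rcases eq_or_ne L ⊤ with rfl | hL_top
  · exact le_top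
  lift L to NNReal using hL_top
  have hspeed : ∀ᶠ t in 𝓝[>] s, edist (u t) (u s) / edist t s < L :=
    (eventually_lt_of_limsup_lt hL).filter_mono (nhdsWithin_mono _ fun t ht => ht.ne')
  have hdist : ∀ᶠ t in 𝓝[>] s, dist (u s) (u t) ≤ L * (t - s) := by
    filter_upwards [hspeed, self_mem_nhdsWithin] with t ht (hst : s < t)
    have hle := ht.le
    rwa [ENNReal.div_le_iff (edist_pos.2 hst.ne').ne' (edist_ne_top _ _), edist_dist, edist_dist,
      ← ENNReal.ofReal_coe_nnreal, ← ENNReal.ofReal_mul L.coe_nonneg,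
      ENNReal.ofReal_le_ofReal_iff (by positivity), Real.dist_eq, abs_of_pos (sub_pos.2 hst),
      dist_comm] at hle
  rw [← ENNReal.ofReal_coe_nnreal]
  exact h.slope_le_of_frequently hE hs.le (h.lt_top s hs) L.coe_nonneg hdist.frequently

lemma lt_top_of_slope_lt_top (h : slope E z < ⊤) : E z < ⊤ := by
  by_contra htop
  rw [not_lt, top_le_iff] at htop
  simp [slope, htop] at h

-- By `dist_sq_le`, `d(u_s, u_t)² ≤ 4 (t - s) (E (u_s) - E (u_t)) ≤ 4 (t - s) L d(u_s, u_t)`.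
lemma IsDescentCurve.eventually_dist_le_of_slope_lt (hE : IsAdmissibleEnergy E)
    (h : IsDescentCurve E κ u) {L : ℝ} (hs : 0 ≤ s) (hL : slope E (u s) < ENNReal.ofReal L) :
    ∀ᶠ t in 𝓝[>] s, dist (u s) (u t) ≤ 4 * L * (t - s) := by
  have hfin : E (u s) < ⊤ := lt_top_of_slope_lt_top (hL.trans ENNReal.ofReal_lt_top)
  have hL_pos : 0 < L := ENNReal.ofReal_pos.1 (bot_le.trans_lt hL)
  rw [slope, if_neg hfin.ne] at hL
  have hsmall : ∀ᶠ t in 𝓝[>] s, κ * (t - s) < 1 / 2 := by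
    have hlim : Tendsto (fun t => κ * (t - s)) (𝓝[>] s) (𝓝 (κ * (s - s))) :=
      (Continuous.tendsto (by fun_prop) _).mono_left nhdsWithin_le_nhds
    exact hlim.eventually (gt_mem_nhds (by norm_num))
  have hquot := (h.tendsto_nhdsGT hs).eventually
    (eventually_nhdsWithin_iff.1 (eventually_lt_of_limsup_lt hL))
  filter_upwards [hquot, hsmall, self_mem_nhdsWithin] with t ht htsmall (hst : s < t)
  have := sub_pos.2 hst
  rcases eq_or_ne (u t) (u s) with heq | hne
  · rw [heq, dist_self]
    positivity
  have hdrop := (hE.toENNReal_sub_div_edist_le_iff hfin (h.lt_top t (hs.trans_lt hst)) hne.symm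
    hL_pos.le).1 (ht hne).le
  refine le_of_mul_le_mul_right ?_ (dist_pos.2 hne.symm)
  calc dist (u s) (u t) * dist (u s) (u t) = dist (u s) (u t) ^ 2 := (sq _).symm
    _ ≤ 4 * (t - s) * ((E (u s)).toReal - (E (u t)).toReal) :=
        h.dist_sq_le hE hs hst.le hfin htsmall.le
    _ ≤ 4 * (t - s) * (L * dist (u s) (u t)) := by gcongr
    _ = 4 * L * (t - s) * dist (u s) (u t) := by ring

lemma IsDescentCurve.toReal_le_of_slope_lt_top (hE : IsAdmissibleEnergy E)
    (h : IsDescentCurve E κ u) (hs : 0 ≤ s) (hslope : slope E (u s) < ⊤) (hy : E y < ⊤) :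
    (E (u s)).toReal ≤ (E y).toReal + 4 * (slope E (u s)).toReal * dist (u s) y
      + κ / 2 * dist (u s) y ^ 2 := by
  have hlim : Tendsto (fun L : ℝ => (E y).toReal + 4 * L * dist (u s) y + κ / 2 * dist (u s) y ^ 2)
      (𝓝[>] (slope E (u s)).toReal) (𝓝 ((E y).toReal + 4 * (slope E (u s)).toReal * dist (u s) y
        + κ / 2 * dist (u s) y ^ 2)) :=
    (Continuous.tendsto (by fun_prop) _).mono_left nhdsWithin_le_nhds
  refine ge_of_tendsto hlim ?_
  filter_upwards [self_mem_nhdsWithin] with L hL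
  have hL_pos : 0 < L := ENNReal.toReal_nonneg.trans_lt hL
  exact h.toReal_le_of_frequently hE hs (lt_top_of_slope_lt_top hslope) (by positivity)
    (h.eventually_dist_le_of_slope_lt hE hs
      ((ENNReal.lt_ofReal_iff_toReal_lt hslope.ne).2 hL)).frequently hy

lemma IsDescentCurve.dist_sq_le_dist_sq_add (hu : IsDescentCurve E κ u) (hv : IsDescentCurve E κ v)
    {C : ℝ} (hs : 0 < s) (hst : s ≤ t)
    (hC : ∀ p ∈ Icc s t, ∀ q ∈ Icc s t, dist (u p) (v q) ^ 2 ≤ C) :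
    dist (u t) (v t) ^ 2 ≤ dist (u s) (v s) ^ 2
      + (t - s) * (2 * ((E (v s)).toReal - (E (v t)).toReal) + 2 * κ * C) := by
  have ht : 0 < t := hs.trans_le hst
  have hκ : 0 ≤ κ / 2 := div_nonneg hu.nonneg zero_le_two
  have hu_integral := mul_le_mul_of_nonneg_left (integral_dist_sq_le hst
    (hu.continuousOn_Icc hs.le) fun r hr => hC r hr s (left_mem_Icc.2 hst)) hκ
  have hv_integral := mul_le_mul_of_nonneg_left (integral_dist_sq_le hst
    (hv.continuousOn_Icc hs.le) fun r hr => by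
      rw [dist_comm]
      exact hC t (right_mem_Icc.2 hst) r hr) hκ
  have hu_evi := hu.dist_sq_add_le (v s) (hv.lt_top s hs) s t hs.le hst ht
  have hv_evi := hv.dist_sq_add_le (u t) (hu.lt_top t ht) s t hs.le hst ht
  rw [dist_comm (v t) (u t), dist_comm (v s) (u t)] at hv_evi
  linarith

lemma IsDescentCurve.eventually_forall_dist_sq_lt (hu : IsDescentCurve E κ u)
    (hv : IsDescentCurve E κ v) {C : ℝ} (hs : 0 ≤ s) (hC : dist (u s) (v s) ^ 2 < C) :
    ∀ᶠ t in 𝓝[>] s, ∀ p ∈ Icc s t, ∀ q ∈ Icc s t, dist (u p) (v q) ^ 2 < C := by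
  have hlim : Tendsto (fun r : ℝ × ℝ => dist (u r.1) (v r.2) ^ 2) (𝓝[≥] s ×ˢ 𝓝[≥] s)
      (𝓝 (dist (u s) (v s) ^ 2)) :=
    (((hu.tendsto_nhdsGE hs).comp tendsto_fst).dist ((hv.tendsto_nhdsGE hs).comp tendsto_snd)).pow 2
  obtain ⟨P, hP, Q, hQ, hPQ⟩ := eventually_prod_iff.1 (hlim.eventually (gt_mem_nhds hC))
  filter_upwards [eventually_forall_Icc hP, eventually_forall_Icc hQ] with t htP htQ p hp q hq
  exact hPQ (htP p hp) (htQ q hq)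

lemma IsDescentCurve.eventually_slope_dist_sq_lt (hE : IsAdmissibleEnergy E)
    (hu : IsDescentCurve E κ u) (hv : IsDescentCurve E κ v) {c : ℝ} (hs : 0 < s)
    (hc : 2 * κ * dist (u s) (v s) ^ 2 < c) :
    ∀ᶠ t in 𝓝[>] s, (t - s)⁻¹ * (dist (u t) (v t) ^ 2 - dist (u s) (v s) ^ 2) < c := by
  obtain ⟨η, hηc, hη⟩ : ∃ η, 2 * η + 2 * κ * (dist (u s) (v s) ^ 2 + η) < c ∧ 0 < η := by
    have hlim : Tendsto (fun η : ℝ => 2 * η + 2 * κ * (dist (u s) (v s) ^ 2 + η)) (𝓝[>] 0)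
        (𝓝 (2 * 0 + 2 * κ * (dist (u s) (v s) ^ 2 + 0))) :=
      (Continuous.tendsto (by fun_prop) _).mono_left nhdsWithin_le_nhds
    exact ((hlim.eventually (gt_mem_nhds (by simpa using hc))).and self_mem_nhdsWithin).exists
  have hlsc : ∀ᶠ t in 𝓝[>] s, E (v t) < ⊤ → (E (v s)).toReal - η < (E (v t)).toReal :=
    (hv.tendsto_nhdsGT hs.le).eventually
      (hE.eventually_lt_toReal (hv.lt_top s hs) (sub_lt_self _ hη))
  filter_upwards [hu.eventually_forall_dist_sq_lt hv hs.le (lt_add_of_pos_right _ hη), hlsc,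
    self_mem_nhdsWithin] with t hnear hEt (hst : s < t)
  have hst_pos : 0 < t - s := sub_pos.2 hst
  rw [inv_mul_lt_iff₀ hst_pos, sub_lt_iff_lt_add']
  refine (hu.dist_sq_le_dist_sq_add hv hs hst.le fun p hp q hq => (hnear p hp q hq).le).trans_lt ?_
  gcongr
  linarith [hEt (hv.lt_top t (hs.trans hst))]

lemma IsDescentCurve.dist_sq_le_exp_of_pos (hE : IsAdmissibleEnergy E)
    (hu : IsDescentCurve E κ u) (hv : IsDescentCurve E κ v) (hs : 0 < s) (hst : s ≤ t) :
    dist (u t) (v t) ^ 2 ≤ dist (u s) (v s) ^ 2 * Real.exp (2 * κ * (t - s)) := by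
  rw [← gronwallBound_ε0]
  exact le_gronwallBound_of_liminf_deriv_right_le (f := fun r => dist (u r) (v r) ^ 2)
    (f' := fun r => 2 * κ * dist (u r) (v r) ^ 2) (b := t)
    ((continuous_dist.comp_continuousOn
      ((hu.continuousOn_Icc hs.le).prodMk (hv.continuousOn_Icc hs.le))).pow 2)
    (fun r hr c hc =>
      (hu.eventually_slope_dist_sq_lt hE hv (hs.trans_le hr.1) hc).frequently)
    le_rfl (fun _ _ => (add_zero _).ge) t ⟨hst, le_rfl⟩

lemma IsDescentCurve.dist_sq_le_exp (hE : IsAdmissibleEnergy E)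
    (hu : IsDescentCurve E κ u) (hv : IsDescentCurve E κ v) (hs : 0 ≤ s) (hst : s ≤ t) :
    dist (u t) (v t) ^ 2 ≤ dist (u s) (v s) ^ 2 * Real.exp (2 * κ * (t - s)) := by
  rcases hst.eq_or_lt with rfl | hlt
  · simp
  have hexp : Tendsto (fun r => Real.exp (2 * κ * (t - r))) (𝓝[>] s)
      (𝓝 (Real.exp (2 * κ * (t - s)))) :=
    (Continuous.tendsto (by fun_prop) _).mono_left nhdsWithin_le_nhds
  refine ge_of_tendsto
    ((((hu.tendsto_nhdsGT hs).dist (hv.tendsto_nhdsGT hs)).pow 2).mul hexp) ?_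
  filter_upwards [Ioo_mem_nhdsGT hlt] with r hr
  exact hu.dist_sq_le_exp_of_pos hE hv (hs.trans_lt hr.1) hr.2.le

lemma IsDescentCurve.dist_le_two_mul (hE : IsAdmissibleEnergy E) (hu : IsDescentCurve E κ u)
    (hv : IsDescentCurve E κ v) (hs : 0 ≤ s) (hst : s ≤ t) (hsmall : κ * (t - s) ≤ 1 / 2) :
    dist (u t) (v t) ≤ 2 * dist (u s) (v s) := by
  refine (abs_le_of_sq_le_sq' ?_ (by positivity)).2
  calc dist (u t) (v t) ^ 2 ≤ dist (u s) (v s) ^ 2 * Real.exp (2 * κ * (t - s)) :=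
        hu.dist_sq_le_exp hE hv hs hst
    _ ≤ dist (u s) (v s) ^ 2 * 4 := by
        gcongr
        calc Real.exp (2 * κ * (t - s)) ≤ Real.exp 1 := Real.exp_le_exp.2 (by linarith)
          _ ≤ 4 := by linarith [Real.exp_one_lt_d9]
    _ = (2 * dist (u s) (v s)) ^ 2 := by ring

lemma IsDescentCurve.shift (h : IsDescentCurve E κ u) (hτ : 0 ≤ τ) :
    IsDescentCurve E κ (fun t => u (t + τ)) where
  nonneg := h.nonneg
  continuousOn := h.continuousOn.comp (by fun_prop) fun _ ht => add_nonneg ht hτ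
  lt_top t ht := h.lt_top _ (by linarith)
  antitoneOn _ hs _ ht hst :=
    h.antitoneOn (add_nonneg hs hτ) (add_nonneg ht hτ) (add_le_add_left hst τ)
  dist_sq_add_le y hy s t hs hst ht := by
    rw [intervalIntegral.integral_comp_add_right (fun r => dist (u r) y ^ 2)]
    simpa only [add_sub_add_right_eq_sub] using
      h.dist_sq_add_le y hy (s + τ) (t + τ) (by linarith) (by linarith) (by linarith)

lemma IsDescentCurve.dist_sq_add_le_of_le (hE : IsAdmissibleEnergy E) (h : IsDescentCurve E κ u)
    {δ : ℝ} (hs : 0 < s) (hst : s ≤ t) (hδ : 0 ≤ δ) (hsmall : κ * (t - s) ≤ 1 / 2)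
    (hδ_small : κ * δ ≤ 1 / 2) :
    dist (u t) (u (t + δ)) ^ 2 ≤ 16 * δ * ((E (u s)).toReal - (E (u (s + δ))).toReal) := by
  calc dist (u t) (u (t + δ)) ^ 2 ≤ (2 * dist (u s) (u (s + δ))) ^ 2 := by
        gcongr
        exact h.dist_le_two_mul hE (h.shift hδ) hs.le hst hsmall
    _ = 4 * dist (u s) (u (s + δ)) ^ 2 := by ring
    _ ≤ 4 * (4 * (s + δ - s) * ((E (u s)).toReal - (E (u (s + δ))).toReal)) := by
        gcongr
        exact h.dist_sq_le hE hs.le (le_add_of_nonneg_right hδ) (h.lt_top s hs)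
          (by rwa [add_sub_cancel_left])
    _ = 16 * δ * ((E (u s)).toReal - (E (u (s + δ))).toReal) := by ring

-- By contraction, each of the `n` increments of `u` over steps of length `δ` in `[τ / 2, τ]`
-- controls the increment over `[τ, τ + δ]`.
lemma IsDescentCurve.mul_dist_sq_le (hE : IsAdmissibleEnergy E) (h : IsDescentCurve E κ u)
    {n : ℕ} {δ : ℝ} (hτ : 0 < τ) (hsmall : κ * τ ≤ 1 / 2) (hδ : 0 ≤ δ) (hn : n * δ = τ / 2) :
    n * dist (u τ) (u (τ + δ)) ^ 2
      ≤ 16 * δ * ((E (u (τ / 2))).toReal - (E (u τ)).toReal) := by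
  have hκ_small : ∀ σ, σ ≤ τ → κ * σ ≤ 1 / 2 := fun σ hσ =>
    (mul_le_mul_of_nonneg_left hσ h.nonneg).trans hsmall
  have hstep : ∀ i ∈ Finset.range n, dist (u τ) (u (τ + δ)) ^ 2
      ≤ 16 * δ * ((E (u (τ / 2 + i * δ))).toReal - (E (u (τ / 2 + (i + 1 : ℕ) * δ))).toReal) := by
    intro i hi
    have hi_nonneg : 0 ≤ i * δ := by positivity
    have hi_le : i * δ + δ ≤ τ / 2 := by
      calc i * δ + δ = (i + 1 : ℕ) * δ := by push_cast; ring
        _ ≤ n * δ := by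
          gcongr
          exact Finset.mem_range.1 hi
        _ = τ / 2 := hn
    have hcast : τ / 2 + (i + 1 : ℕ) * δ = τ / 2 + i * δ + δ := by push_cast; ring
    rw [hcast]
    exact h.dist_sq_add_le_of_le hE (by linarith) (by linarith) hδ (hκ_small _ (by linarith))
      (hκ_small _ (by linarith))
  have hsum := Finset.sum_le_sum hstep
  rwa [← Finset.mul_sum, Finset.sum_range_sub' (fun i : ℕ => (E (u (τ / 2 + i * δ))).toReal),
    Finset.sum_const, Finset.card_range, nsmul_eq_mul, Nat.cast_zero, zero_mul, add_zero, hn,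
    add_halves] at hsum

lemma IsDescentCurve.slope_le_sqrt (hE : IsAdmissibleEnergy E) (h : IsDescentCurve E κ u)
    (hτ : 0 < τ) (hsmall : κ * τ ≤ 1 / 2) :
    slope E (u τ) ≤ ENNReal.ofReal √(32 * ((E (u (τ / 2))).toReal - (E (u τ)).toReal) / τ) := by
  set drop := (E (u (τ / 2))).toReal - (E (u τ)).toReal
  have hdrop : 0 ≤ drop := sub_nonneg.2
    (h.toReal_anti hE (half_pos hτ).le (half_le_self hτ.le) (h.lt_top _ (half_pos hτ)))
  refine h.slope_le_of_frequently hE hτ.le (h.lt_top τ hτ) (Real.sqrt_nonneg _) ?_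
  have hstep : ∀ n : ℕ, 0 < n → dist (u τ) (u (τ + τ / 2 / n))
      ≤ √(32 * drop / τ) * (τ + τ / 2 / n - τ) := by
    intro n hn
    set δ := τ / 2 / n
    have hδ : n * δ = τ / 2 := mul_div_cancel₀ _ (Nat.cast_ne_zero.2 hn.ne')
    have hδ_nonneg : 0 ≤ δ := by positivity
    rw [add_sub_cancel_left]
    refine (abs_le_of_sq_le_sq' ?_ (by positivity)).2
    rw [mul_pow, Real.sq_sqrt (by positivity), div_mul_eq_mul_div, le_div_iff₀ hτ]
    calc dist (u τ) (u (τ + δ)) ^ 2 * τ = 2 * δ * (n * dist (u τ) (u (τ + δ)) ^ 2) := by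
          linear_combination (-2) * dist (u τ) (u (τ + δ)) ^ 2 * hδ
      _ ≤ 2 * δ * (16 * δ * drop) := by
          exact mul_le_mul_of_nonneg_left (h.mul_dist_sq_le hE hτ hsmall hδ_nonneg hδ)
            (by positivity)
      _ = 32 * drop * δ ^ 2 := by ring
  have htends : Tendsto (fun n : ℕ => τ + τ / 2 / n) atTop (𝓝[>] τ) := by
    refine tendsto_nhdsWithin_iff.2 ⟨?_, ?_⟩
    · simpa using (tendsto_const_div_atTop_nhds_zero_nat (τ / 2)).const_add τ
    · filter_upwards [eventually_gt_atTop 0] with n hn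
      exact mem_Ioi.2 (lt_add_of_pos_right _ (by positivity))
  refine htends.frequently (Eventually.frequently ?_)
  filter_upwards [eventually_gt_atTop 0] with n hn using hstep n hn

lemma IsDescentCurve.toReal_le_of_forall_dist_le (h : IsDescentCurve E κ u) {B : ℝ} (ht : 0 < t)
    (hy : E y < ⊤) (hB : ∀ r ∈ Icc 0 t, dist (u r) y ≤ B) :
    (E (u t)).toReal ≤ B ^ 2 / (2 * t) + (E y).toReal + κ / 2 * B ^ 2 := by
  have hB_sq : ∀ r ∈ Icc 0 t, dist (u r) y ^ 2 ≤ B ^ 2 := fun r hr => by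
    gcongr
    exact hB r hr
  have hintegral : κ / 2 * ∫ r in (0 : ℝ)..t, dist (u r) y ^ 2 ≤ κ / 2 * ((t - 0) * B ^ 2) :=
    mul_le_mul_of_nonneg_left (integral_dist_sq_le ht.le (h.continuousOn_Icc le_rfl) hB_sq)
      (div_nonneg h.nonneg zero_le_two)
  have hevi := h.dist_sq_add_le y hy 0 t le_rfl ht.le ht
  have hcancel : t * (B ^ 2 / (2 * t)) = B ^ 2 / 2 := by field_simp
  refine le_of_mul_le_mul_left ?_ ht
  linarith [hB_sq 0 ⟨le_rfl, ht.le⟩, sq_nonneg (dist (u t) y)]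

lemma IsDescentCurve.exists_dist_le (hE : IsAdmissibleEnergy E) (hv : IsDescentCurve E κ v)
    (hsmall : κ * τ ≤ 1 / 2) (R : ℝ) :
    ∃ B : ℝ, ∀ u, IsDescentCurve E κ u → dist (u 0) (v 0) ≤ R →
      ∀ r ∈ Icc 0 τ, dist (u r) (v 0) ≤ B := by
  obtain ⟨ρ, hρ⟩ := (isCompact_Icc.image_of_continuousOn
    (hv.continuousOn_Icc (t := τ) le_rfl)).isBounded.subset_closedBall (v 0)
  refine ⟨2 * R + ρ, fun u hu hdist r hr => ?_⟩
  have hr_small : κ * (r - 0) ≤ 1 / 2 := by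
    rw [sub_zero]
    exact (mul_le_mul_of_nonneg_left hr.2 hv.nonneg).trans hsmall
  calc dist (u r) (v 0) ≤ dist (u r) (v r) + dist (v r) (v 0) := dist_triangle _ _ _
    _ ≤ 2 * R + ρ := by
        gcongr
        · exact (hu.dist_le_two_mul hE hv le_rfl hr.1 hr_small).trans (by gcongr)
        · exact hρ (mem_image_of_mem v hr)

lemma IsDescentCurve.exists_slope_le (hE : IsAdmissibleEnergy E) (hv : IsDescentCurve E κ v)
    (hfin : E (v 0) < ⊤) (hτ : 0 < τ) (hsmall : κ * τ ≤ 1 / 2) (R : ℝ) :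
    ∃ K : ℝ, ∀ u, IsDescentCurve E κ u → dist (u 0) (v 0) ≤ R →
      slope E (u τ) ≤ ENNReal.ofReal K := by
  obtain ⟨B, hB⟩ := hv.exists_dist_le hE hsmall R
  obtain ⟨c, hc⟩ := hE.exists_le_toReal (Metric.isBounded_closedBall (x := v 0) (r := B))
  refine ⟨√(32 * (B ^ 2 / (2 * (τ / 2)) + (E (v 0)).toReal + κ / 2 * B ^ 2 - c) / τ),
    fun u hu hdist => (hu.slope_le_sqrt hE hτ hsmall).trans ?_⟩
  have hball := hB u hu hdist
  gcongr
  · exact hu.toReal_le_of_forall_dist_le (half_pos hτ) hfin fun r hr =>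
      hball r ⟨hr.1, hr.2.trans (half_le_self hτ.le)⟩
  · exact hc _ (hball τ ⟨hτ.le, le_rfl⟩) (hu.lt_top τ hτ)

end Descent

section RegularisedCurve

variable {X : Type*} {S : X → ℝ → X} {γ : ℝ → X} {τ t : ℝ}

/-- The curve obtained by following the flow `S` from `γ 0` during time `τ`, then the flow at time
`τ` of the rescaled curve `γ`, and finally the reversed flow from `γ 1`. -/
noncomputable def regularised (S : X → ℝ → X) (γ : ℝ → X) (τ : ℝ) (t : ℝ) : X :=
  if t ≤ 1 - τ then (if t ≤ τ then S (γ 0) t else S (γ ((t - τ) / (1 - 2 * τ))) τ)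
  else S (γ 1) (1 - t)

lemma regularised_of_le (hτ : 2 * τ < 1) (ht : t ≤ τ) :
    regularised S γ τ t = S (γ 0) t := by
  rw [regularised, if_pos (by linarith), if_pos ht]

lemma regularised_of_lt_of_le (ht : τ < t) (ht' : t ≤ 1 - τ) :
    regularised S γ τ t = S (γ ((t - τ) / (1 - 2 * τ))) τ := by
  rw [regularised, if_pos ht', if_neg ht.not_ge]

lemma regularised_of_one_sub_lt (ht : 1 - τ < t) :
    regularised S γ τ t = S (γ 1) (1 - t) := by
  rw [regularised, if_neg ht.not_ge]

end RegularisedCurve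

section Regularisation

variable {X : Type*} [MetricSpace X] {E : X → EReal} {κ τ a b : ℝ} {u γ ω : ℝ → X} {e : ℝ → ℝ}
  {S : X → ℝ → X}

/-- A choice, for every point `z`, of a descent curve `S z` starting from `z`, all with the same
constant `κ`. -/
structure IsDescentFlow (E : X → EReal) (κ : ℝ) (S : X → ℝ → X) : Prop where
  zero : ∀ z, S z 0 = z
  isDescentCurve : ∀ z, IsDescentCurve E κ (S z)

lemma IsAdmissibleEnergy.exists_isDescentFlow (hE : IsAdmissibleEnergy E) :
    ∃ κ S, IsDescentFlow E κ S := by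
  obtain ⟨lam, hflow⟩ := hE.flow
  choose γ hγ using hflow
  exact ⟨|lam|, fun z => Function.update (γ z) 0 z, fun z => Function.update_self .., fun z =>
    (hγ z).isDescentCurve_update hE⟩

lemma exists_mul_le_of_lintegral_ne_top {f : ℝ → ℝ≥0∞} (hab : a < b)
    (hfin : ∫⁻ t in Ioo a b, f t ≠ ⊤) :
    ∃ s ∈ Ioo a b, f s < ⊤ ∧
      (f s).toReal * (b - a) ≤ (∫⁻ t in Ioo a b, f t).toReal + (b - a) := by
  have hpos : 0 < b - a := sub_pos.2 hab
  set c := (∫⁻ t in Ioo a b, f t).toReal / (b - a) + 1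
  have hc : c * (b - a) = (∫⁻ t in Ioo a b, f t).toReal + (b - a) := by
    simp only [c]
    field_simp
  suffices h : ∃ s ∈ Ioo a b, f s < ENNReal.ofReal c by
    obtain ⟨s, hs, hfs⟩ := h
    refine ⟨s, hs, hfs.trans ENNReal.ofReal_lt_top, ?_⟩
    rw [← hc]
    gcongr
    exact ENNReal.toReal_le_of_le_ofReal (by positivity) hfs.le
  by_contra! hle
  have hintegral : ENNReal.ofReal (c * (b - a)) ≤ ∫⁻ t in Ioo a b, f t :=
    calc ENNReal.ofReal (c * (b - a)) = ∫⁻ _ in Ioo a b, ENNReal.ofReal c := by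
          rw [setLIntegral_const, Real.volume_Ioo, ← ENNReal.ofReal_mul (by positivity)]
      _ ≤ ∫⁻ t in Ioo a b, f t := setLIntegral_mono' measurableSet_Ioo hle
  rw [ENNReal.ofReal_le_iff_le_toReal hfin, hc] at hintegral
  linarith

lemma IsDescentCurve.toReal_le_add_of_hasEnergyBound (hE : IsAdmissibleEnergy E)
    (h : IsDescentCurve E κ u) (hω : HasEnergyBound ω e a b) (hu : u 0 = ω a) (hab : a ≤ b)
    (hba_one : b - a ≤ 1) (hτ : 0 < τ) (hba : b - a ≤ 4 * τ) (hslope : slope E (ω a) < ⊤)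
    (hfin : E (ω b) < ⊤) :
    (E (ω a)).toReal ≤ (E (ω b)).toReal + 2 * ((slope E (ω a)).toReal ^ 2 * τ)
      + (8 + κ / 2) * (e b - e a) := by
  set d := dist (ω a) (ω b)
  set σ := (slope E (ω a)).toReal
  have he : 0 ≤ e b - e a := sub_nonneg.2 (hω.monotoneOn ⟨le_rfl, hab⟩ ⟨hab, le_rfl⟩ hab)
  have hd : d ^ 2 ≤ (b - a) * (e b - e a) := hω a b le_rfl hab le_rfl
  have hd_le : d ^ 2 ≤ e b - e a := hd.trans (mul_le_of_le_one_left he hba_one)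
  have hd_le_mul : d ^ 2 ≤ 4 * τ * (e b - e a) := hd.trans (mul_le_mul_of_nonneg_right hba he)
  -- Young's inequality: `4 σ d ≤ 2 σ² τ + 2 d² / τ`, where `d² ≤ 4 τ (e b - e a)`.
  have hyoung : 4 * σ * d ≤ 2 * (σ ^ 2 * τ) + 8 * (e b - e a) := by
    refine le_of_mul_le_mul_right ?_ hτ
    linarith [sq_nonneg (σ * τ - d)]
  have hκ : κ / 2 * d ^ 2 ≤ κ / 2 * (e b - e a) :=
    mul_le_mul_of_nonneg_left hd_le (div_nonneg h.nonneg zero_le_two)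
  have hle := h.toReal_le_of_slope_lt_top hE le_rfl (by rwa [hu]) hfin
  rw [hu] at hle
  linarith

lemma exists_dyadic_mul_le_of_lintegral_ne_top {f : ℝ → ℝ≥0∞}
    (hfin : ∫⁻ t in Ioo (0 : ℝ) 1, f t ≠ ⊤) (k : ℕ) :
    ∃ s ∈ Ioo ((1 / 2 : ℝ) ^ (k + 1)) ((1 / 2) ^ k), f s < ⊤ ∧
      (f s).toReal * (1 / 2) ^ (k + 1) ≤ (∫⁻ t in Ioo 0 ((1 / 2 : ℝ) ^ k), f t).toReal
        - (∫⁻ t in Ioo 0 ((1 / 2 : ℝ) ^ (k + 1)), f t).toReal + (1 / 2) ^ (k + 1) := by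
  have hhalf : (1 / 2 : ℝ) ^ k - (1 / 2) ^ (k + 1) = (1 / 2) ^ (k + 1) := by ring
  have hlt : (1 / 2 : ℝ) ^ (k + 1) < (1 / 2) ^ k := by
    rw [← sub_pos, hhalf]
    positivity
  have hle_one : (1 / 2 : ℝ) ^ k ≤ 1 := pow_le_one₀ (by norm_num) (by norm_num)
  have hmono : ∀ c, 0 ≤ c → ∫⁻ t in Ioo c ((1 / 2 : ℝ) ^ k), f t ≠ ⊤ := fun c hc =>
    ne_top_of_le_ne_top hfin (lintegral_mono_set (Ioo_subset_Ioo hc hle_one))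
  rw [toReal_lintegral_Ioo_sub (by positivity) hlt.le (hmono 0 le_rfl)]
  simpa only [hhalf] using
    exists_mul_le_of_lintegral_ne_top hlt (hmono _ (by positivity))

-- With `s k` chosen in the dyadic interval `(2⁻ᵏ⁻¹, 2⁻ᵏ)`, `Φ k` below is nonincreasing in `k`.
lemma exists_seq_tendsto_zero_forall_le (hE : IsAdmissibleEnergy E) (hω : HasEnergyBound ω e 0 1)
    (hfin : ∫⁻ t in Ioo (0 : ℝ) 1, slope E (ω t) ^ 2 ≠ ⊤) :
    ∃ (s : ℕ → ℝ) (C : ℝ), Tendsto s atTop (𝓝[Icc 0 1] 0) ∧ ∀ k, E (ω (s k)) ≤ C := by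
  obtain ⟨κ, S, hS⟩ := hE.exists_isDescentFlow
  have hκ : 0 ≤ κ := (hS.isDescentCurve (ω 0)).nonneg
  choose s hs hs_lt_top hs_le using exists_dyadic_mul_le_of_lintegral_ne_top hfin
  have hs_mem : ∀ k, s k ∈ Icc (0 : ℝ) 1 := fun k =>
    ⟨(by positivity : (0 : ℝ) ≤ (1 / 2) ^ (k + 1)).trans (hs k).1.le,
      (hs k).2.le.trans (pow_le_one₀ (by norm_num) (by norm_num))⟩
  have hslope : ∀ k, slope E (ω (s k)) < ⊤ := fun k =>
    (ENNReal.pow_lt_top_iff.1 (hs_lt_top k)).resolve_right two_ne_zero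
  have hEs : ∀ k, E (ω (s k)) < ⊤ := fun k => lt_top_of_slope_lt_top (hslope k)
  have he : ∀ k, 0 ≤ e (s k) - e 0 := fun k =>
    sub_nonneg.2 (hω.monotoneOn ⟨le_rfl, zero_le_one⟩ (hs_mem k) (hs_mem k).1)
  let Q : ℕ → ℝ := fun k => (∫⁻ t in Ioo 0 ((1 / 2 : ℝ) ^ k), slope E (ω t) ^ 2).toReal
  let Φ : ℕ → ℝ := fun k => (E (ω (s k))).toReal + 2 * Q (k + 1) + 2 * (1 / 2) ^ (k + 1)
    + (8 + κ / 2) * (e (s k) - e 0)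
  have hΦ : ∀ k, Φ (k + 1) ≤ Φ k := fun k => by
    have hstep := (hS.isDescentCurve (ω (s (k + 1)))).toReal_le_add_of_hasEnergyBound hE
      (hω.mono (hs_mem (k + 1)).1 (hs_mem k).2) (hS.zero _) ((hs (k + 1)).2.trans (hs k).1).le
      (by linarith [(hs_mem (k + 1)).1, (hs_mem k).2]) (τ := (1 / 2) ^ (k + 1 + 1)) (by positivity)
      (by linarith [(hs_mem (k + 1)).1, (hs k).2, pow_succ (1 / 2 : ℝ) (k + 1),
        pow_succ (1 / 2 : ℝ) k]) (hslope _) (hEs k)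
    have hchoice := hs_le (k + 1)
    rw [ENNReal.toReal_pow] at hchoice
    simp only [Φ, Q]
    linarith [pow_succ (1 / 2 : ℝ) (k + 1)]
  refine ⟨s, Φ 0, tendsto_nhdsWithin_iff.2 ⟨?_, Eventually.of_forall hs_mem⟩, fun k => ?_⟩
  · exact squeeze_zero (fun k => (hs_mem k).1) (fun k => (hs k).2.le)
      (tendsto_pow_atTop_nhds_zero_of_lt_one (by norm_num) (by norm_num))
  · rw [← hE.coe_toReal (hEs k), EReal.coe_le_coe_iff]
    calc (E (ω (s k))).toReal ≤ Φ k := by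
          have := he k
          have : 0 ≤ Q (k + 1) := ENNReal.toReal_nonneg
          simp only [Φ, add_assoc]
          exact le_add_of_nonneg_right (by positivity)
      _ ≤ Φ 0 := antitone_nat_of_succ_le hΦ (Nat.zero_le k)

lemma lt_top_of_lintegral_slope_sq (hE : IsAdmissibleEnergy E) (hω : HasEnergyBound ω e 0 1)
    (hfin : ∫⁻ t in Ioo (0 : ℝ) 1, slope E (ω t) ^ 2 ≠ ⊤) : E (ω 0) < ⊤ := by
  obtain ⟨s, C, hs, hC⟩ := exists_seq_tendsto_zero_forall_le hE hω hfin
  have hlim : Tendsto (fun k => ω (s k)) atTop (𝓝 (ω 0)) :=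
    (hω.continuousOn zero_le_one 0 ⟨le_rfl, zero_le_one⟩).tendsto.comp hs
  have hmem : ω 0 ∈ E ⁻¹' Iic (C : EReal) :=
    (hE.lsc.isClosed_preimage _).mem_of_tendsto hlim (Eventually.of_forall hC)
  exact (mem_Iic.1 hmem).trans_lt (EReal.coe_lt_top _)

lemma lintegral_Ioo_comp_one_sub (f : ℝ → ℝ≥0∞) :
    ∫⁻ t in Ioo (0 : ℝ) 1, f (1 - t) = ∫⁻ t in Ioo (0 : ℝ) 1, f t := by
  have hsub := Measure.measurePreserving_sub_left volume (1 : ℝ)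
  have hpreimage := hsub.setLIntegral_comp_preimage_emb
    (Homeomorph.subLeft (1 : ℝ)).measurableEmbedding f (Ioo 0 1)
  simpa using hpreimage

lemma lt_top_and_lt_top_of_fisher (hE : IsAdmissibleEnergy E) (hω : IsAC2 ω)
    (hI : fisher E ω < ⊤) : E (ω 0) < ⊤ ∧ E (ω 1) < ⊤ := by
  have hfin : ∫⁻ t in Ioo (0 : ℝ) 1, slope E (ω t) ^ 2 ≠ ⊤ := by
    intro htop
    simp [fisher, htop] at hI
  have hreverse := hω.hasEnergyBound.reverse (c := 1)
  rw [sub_self, sub_zero] at hreverse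
  refine ⟨lt_top_of_lintegral_slope_sq hE hω.hasEnergyBound hfin, ?_⟩
  simpa using lt_top_of_lintegral_slope_sq hE hreverse
    (by rwa [lintegral_Ioo_comp_one_sub (fun t => slope E (ω t) ^ 2)])

lemma HasEnergyBound.glue {γ₁ γ₂ : ℝ → X} {e₁ e₂ : ℝ → ℝ} {c : ℝ} (hab : a ≤ b) (hbc : b < c)
    (h₁ : HasEnergyBound γ₁ e₁ a b) (h₂ : HasEnergyBound γ₂ e₂ b c) (hb : γ₁ b = γ₂ b) :
    ∃ e, HasEnergyBound (fun t => if t ≤ b then γ₁ t else γ₂ t) e a c ∧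
      e c - e a = (e₁ b - e₁ a) + (e₂ c - e₂ b) := by
  have hγ : ∀ r, b ≤ r → (if r ≤ b then γ₁ r else γ₂ r) = γ₂ r := fun r hr =>
    ite_eq_right_iff.2 fun hle => by rw [hle.antisymm hr, hb]
  have he : ∀ r, b ≤ r → (if r ≤ b then e₁ r else e₂ r - e₂ b + e₁ b) = e₂ r - e₂ b + e₁ b :=
    fun r hr => ite_eq_right_iff.2 fun hle => by rw [hle.antisymm hr]; ring
  refine ⟨fun t => if t ≤ b then e₁ t else e₂ t - e₂ b + e₁ b,
    HasEnergyBound.union (b := b) (fun s t hs hst ht => ?_) (fun s t hs hst ht => ?_), ?_⟩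
  · simpa only [if_pos (hst.trans ht), if_pos ht] using h₁ s t hs hst ht
  · rw [hγ s hs, hγ t (hs.trans hst)]
    simp only [he s hs, he t (hs.trans hst), add_sub_add_right_eq_sub, sub_sub_sub_cancel_right]
    exact h₂ s t hs hst ht
  · simp only [if_neg hbc.not_ge, if_pos hab]
    ring

lemma HasEnergyBound.comp_of_dist_sq_le {Y : Type*} [MetricSpace Y] {f : X → Y} {C : ℝ}
    (h : HasEnergyBound γ e a b) (hC : 0 ≤ C)
    (hf : ∀ p q, dist (f p) (f q) ^ 2 ≤ C * dist p q ^ 2) :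
    HasEnergyBound (fun t => f (γ t)) (fun t => C * e t) a b := fun s t hs hst ht =>
  calc dist (f (γ s)) (f (γ t)) ^ 2 ≤ C * dist (γ s) (γ t) ^ 2 := hf _ _
    _ ≤ C * ((t - s) * (e t - e s)) := mul_le_mul_of_nonneg_left (h s t hs hst ht) hC
    _ = (t - s) * (C * e t - C * e s) := by ring

lemma HasEnergyBound.comp_sub_div {c d : ℝ} (h : HasEnergyBound γ e a b) (hc : 0 < c) :
    HasEnergyBound (fun t => γ ((t - d) / c)) (fun t => e ((t - d) / c) / c)
      (a * c + d) (b * c + d) := by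
  intro s t hs hst ht
  calc dist (γ ((s - d) / c)) (γ ((t - d) / c)) ^ 2
      ≤ ((t - d) / c - (s - d) / c) * (e ((t - d) / c) - e ((s - d) / c)) := by
        refine h _ _ ?_ (by gcongr) ?_
        · rw [le_div_iff₀ hc]
          linarith
        · rw [div_le_iff₀ hc]
          linarith
    _ = (t - s) * (e ((t - d) / c) / c - e ((s - d) / c) / c) := by ring

lemma metricSpeed_comp_one_sub (γ : ℝ → X) (t : ℝ) :
    metricSpeed (fun s => γ (1 - s)) t = metricSpeed γ (1 - t) := by
  have hmap : map (fun s => 1 - s) (𝓝[≠] t) = 𝓝[≠] (1 - t) :=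
    (Homeomorph.subLeft (1 : ℝ)).map_punctured_nhds_eq t
  rw [metricSpeed, metricSpeed, ← hmap, ← limsup_comp]
  simp only [Function.comp_def, edist_sub_left]

lemma IsDescentCurve.hasEnergyBound (hE : IsAdmissibleEnergy E) (h : IsDescentCurve E κ u)
    (hfin : E (u 0) < ⊤) (hsmall : κ * τ ≤ 1 / 2) :
    HasEnergyBound u (fun t => -4 * (E (u t)).toReal) 0 τ := by
  intro s t hs hst ht
  have hsmall_st : κ * (t - s) ≤ 1 / 2 :=
    (mul_le_mul_of_nonneg_left (by linarith) h.nonneg).trans hsmall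
  have hbound := h.dist_sq_le hE hs hst
    ((h.antitoneOn self_mem_Ici (mem_Ici.2 hs) hs).trans_lt hfin) hsmall_st
  linarith

lemma IsDescentFlow.joins_regularised (hS : IsDescentFlow E κ S) (hτ : 0 < τ) (hτ_half : 2 * τ < 1)
    (hcont : ContinuousOn (regularised S γ τ) (Icc 0 1)) :
    Joins (regularised S γ τ) (γ 0) (γ 1) := by
  refine ⟨hcont, ?_, ?_⟩
  · rw [regularised_of_le hτ_half hτ.le, hS.zero]
  · rw [regularised_of_one_sub_lt (sub_lt_self 1 hτ), sub_self, hS.zero]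

lemma IsDescentFlow.exists_hasEnergyBound_regularised (hE : IsAdmissibleEnergy E)
    (hS : IsDescentFlow E κ S) (hγ : IsAC2 γ) (h0 : E (γ 0) < ⊤) (h1 : E (γ 1) < ⊤) (hτ : 0 < τ)
    (hτ_half : 2 * τ < 1) (hsmall : κ * τ ≤ 1 / 2) :
    ∃ e, HasEnergyBound (regularised S γ τ) e 0 1 ∧
      e 1 - e 0 = 4 * ((E (γ 0)).toReal - (E (S (γ 0) τ)).toReal)
        + Real.exp (2 * κ * τ) / (1 - 2 * τ) * (2 * (kinetic γ).toReal)
        + 4 * ((E (γ 1)).toReal - (E (S (γ 1) τ)).toReal) := by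
  have hpos : 0 < 1 - 2 * τ := by linarith
  have hstart := (hS.isDescentCurve (γ 0)).hasEnergyBound hE (by rwa [hS.zero]) hsmall
  have hend := ((hS.isDescentCurve (γ 1)).hasEnergyBound hE (by rwa [hS.zero]) hsmall).reverse
    (c := 1)
  have hmiddle := (hγ.hasEnergyBound.comp_sub_div (d := τ) hpos).comp_of_dist_sq_le
    (f := fun z => S z τ) (C := Real.exp (2 * κ * τ)) (Real.exp_pos _).le fun p q => by
      simpa [hS.zero, mul_comm] using
        (hS.isDescentCurve p).dist_sq_le_exp hE (hS.isDescentCurve q) le_rfl hτ.le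
  rw [sub_zero] at hend
  rw [zero_mul, zero_add, one_mul, show 1 - 2 * τ + τ = 1 - τ by ring] at hmiddle
  have hdiv : (1 - τ - τ) / (1 - 2 * τ) = 1 := by
    rw [div_eq_one_iff_eq hpos.ne']
    ring
  obtain ⟨e', he', hdiff'⟩ := hstart.glue hτ.le (by linarith) hmiddle (by simp)
  obtain ⟨e, he, hdiff⟩ := he'.glue (by linarith) (by linarith) hend (by
    rw [if_neg (by linarith), hdiv, sub_sub_cancel])
  refine ⟨e, he, ?_⟩
  rw [hdiff, hdiff', hdiv, hγ.energy_eq]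
  simp only [sub_self, zero_div, energy_self, hS.zero, sub_sub_cancel]
  ring

-- On the two outer pieces the curve is a descent curve, up to reversal of time.
lemma IsDescentFlow.slope_regularised_sq_le (hE : IsAdmissibleEnergy E) (hS : IsDescentFlow E κ S)
    (hτ_half : 2 * τ < 1) {K : ℝ≥0∞} (hK : ∀ t ∈ Icc (0 : ℝ) 1, slope E (S (γ t) τ) ≤ K) {t : ℝ}
    (ht : t ∈ Ioo (0 : ℝ) 1) (htτ : t ≠ τ) (htτ' : t ≠ 1 - τ) :
    slope E (regularised S γ τ t) ^ 2 ≤ metricSpeed (regularised S γ τ) t ^ 2 + K ^ 2 := by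
  have hpos : 0 < 1 - 2 * τ := by linarith
  rcases htτ.lt_or_gt with hlt | hgt
  · have heq : regularised S γ τ =ᶠ[𝓝 t] S (γ 0) := by
      filter_upwards [Iio_mem_nhds hlt] with s hs using regularised_of_le hτ_half (mem_Iio.1 hs).le
    rw [metricSpeed_congr heq, heq.self_of_nhds]
    exact le_add_right (pow_le_pow_left₀ zero_le
      ((hS.isDescentCurve (γ 0)).slope_le_metricSpeed hE ht.1) 2)
  rcases htτ'.lt_or_gt with hlt' | hgt'
  · rw [regularised_of_lt_of_le hgt hlt'.le]
    refine le_add_left (pow_le_pow_left₀ zero_le (hK _ ⟨div_nonneg (by linarith) hpos.le, ?_⟩) 2)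
    rw [div_le_one hpos]
    linarith
  · have heq : regularised S γ τ =ᶠ[𝓝 t] fun s => S (γ 1) (1 - s) := by
      filter_upwards [Ioi_mem_nhds hgt'] with s hs using regularised_of_one_sub_lt hs
    rw [metricSpeed_congr heq, heq.self_of_nhds, metricSpeed_comp_one_sub]
    exact le_add_right (pow_le_pow_left₀ zero_le
      ((hS.isDescentCurve (γ 1)).slope_le_metricSpeed hE (sub_pos.2 ht.2)) 2)

lemma IsDescentFlow.exists_slope_le (hE : IsAdmissibleEnergy E) (hS : IsDescentFlow E κ S)
    (hγ : ContinuousOn γ (Icc 0 1)) (h0 : E (γ 0) < ⊤) (hτ : 0 < τ) (hsmall : κ * τ ≤ 1 / 2) :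
    ∃ K : ℝ, ∀ t ∈ Icc (0 : ℝ) 1, slope E (S (γ t) τ) ≤ ENNReal.ofReal K := by
  obtain ⟨R, hR⟩ :=
    (isCompact_Icc.image_of_continuousOn hγ).isBounded.subset_closedBall (γ 0)
  obtain ⟨K, hK⟩ := (hS.isDescentCurve (γ 0)).exists_slope_le hE (by rwa [hS.zero]) hτ hsmall R
  refine ⟨K, fun t ht => hK _ (hS.isDescentCurve _) ?_⟩
  rw [hS.zero, hS.zero]
  exact hR (mem_image_of_mem γ ht)

lemma IsDescentFlow.fisher_regularised_lt_top (hE : IsAdmissibleEnergy E)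
    (hS : IsDescentFlow E κ S) (hγ : ContinuousOn γ (Icc 0 1)) (h0 : E (γ 0) < ⊤) (hτ : 0 < τ)
    (hτ_half : 2 * τ < 1) (hsmall : κ * τ ≤ 1 / 2)
    (hbound : HasEnergyBound (regularised S γ τ) e 0 1) :
    fisher E (regularised S γ τ) < ⊤ := by
  obtain ⟨K, hK⟩ := hS.exists_slope_le hE hγ h0 hτ hsmall
  have hae : ∀ᵐ t ∂volume.restrict (Ioo (0 : ℝ) 1), slope E (regularised S γ τ t) ^ 2
      ≤ metricSpeed (regularised S γ τ) t ^ 2 + ENNReal.ofReal K ^ 2 := by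
    filter_upwards [ae_restrict_mem measurableSet_Ioo, ae_restrict_of_ae (Measure.ae_ne volume τ),
      ae_restrict_of_ae (Measure.ae_ne volume (1 - τ))] with t ht htτ htτ'
    exact hS.slope_regularised_sq_le hE hτ_half hK ht htτ htτ'
  have hfin : ∫⁻ t in Ioo (0 : ℝ) 1,
      (metricSpeed (regularised S γ τ) t ^ 2 + ENNReal.ofReal K ^ 2) < ⊤ := by
    rw [lintegral_add_right _ measurable_const, ENNReal.add_lt_top]
    exact ⟨(hbound.lintegral_metricSpeed_sq_le zero_le_one).trans_lt ENNReal.ofReal_lt_top, by simp⟩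
  exact ENNReal.mul_lt_top (by simp) ((lintegral_mono_ae hae).trans_lt hfin)

lemma IsDescentFlow.eventually_sub_lt_toReal (hE : IsAdmissibleEnergy E) (hS : IsDescentFlow E κ S)
    {z : X} (hz : E z < ⊤) {η : ℝ} (hη : 0 < η) :
    ∀ᶠ t in 𝓝[>] 0, (E z).toReal - η < (E (S z t)).toReal := by
  have hlim := (hS.isDescentCurve z).tendsto_nhdsGT le_rfl
  rw [hS.zero] at hlim
  filter_upwards [hlim.eventually (hE.eventually_lt_toReal hz (sub_lt_self _ hη)),
    self_mem_nhdsWithin] with t hlt ht using hlt ((hS.isDescentCurve z).lt_top t ht)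

lemma exists_joins_fisher_lt_top (hE : IsAdmissibleEnergy E) (hγ : IsAC2 γ)
    (h0 : E (γ 0) < ⊤) (h1 : E (γ 1) < ⊤) {η : ℝ} (hη : 0 < η) :
    ∃ w, Joins w (γ 0) (γ 1) ∧ kinetic w ≤ kinetic γ + ENNReal.ofReal η ∧ fisher E w < ⊤ := by
  obtain ⟨κ, S, hS⟩ := hE.exists_isDescentFlow
  set A := (kinetic γ).toReal
  have hkinetic : ∀ᶠ τ in 𝓝[>] (0 : ℝ), Real.exp (2 * κ * τ) / (1 - 2 * τ) * A < A + η / 4 := by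
    have hcont : ContinuousAt (fun τ : ℝ => Real.exp (2 * κ * τ) / (1 - 2 * τ) * A) 0 := by
      fun_prop (disch := norm_num)
    refine (hcont.tendsto.mono_left nhdsWithin_le_nhds).eventually (gt_mem_nhds ?_)
    simp only [mul_zero, Real.exp_zero, sub_zero, div_one, one_mul]
    linarith
  have hsmall : ∀ᶠ τ in 𝓝[>] (0 : ℝ), 2 * τ < 1 ∧ κ * τ < 1 / 2 := by
    refine nhdsWithin_le_nhds (Eventually.and ?_ ?_) <;>
    exact (Continuous.tendsto' (by fun_prop) (0 : ℝ) 0 (by simp)).eventually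
      (gt_mem_nhds (by norm_num))
  obtain ⟨τ, hτ_kinetic, ⟨hτ_half, hτ_small⟩, hτ_start, hτ_end, hτ⟩ := (hkinetic.and <|
    hsmall.and <| (hS.eventually_sub_lt_toReal hE h0 (η := η / 8) (by positivity)).and <|
    (hS.eventually_sub_lt_toReal hE h1 (η := η / 8) (by positivity)).and
    self_mem_nhdsWithin).exists
  obtain ⟨e, he, hdiff⟩ :=
    hS.exists_hasEnergyBound_regularised hE hγ h0 h1 hτ hτ_half hτ_small.le
  refine ⟨regularised S γ τ, hS.joins_regularised hτ hτ_half (he.continuousOn zero_le_one), ?_,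
    hS.fisher_regularised_lt_top hE (hγ.1.continuousOn zero_le_one) h0 hτ hτ_half hτ_small.le he⟩
  calc kinetic (regularised S γ τ) ≤ ENNReal.ofReal ((e 1 - e 0) / 2) := he.kinetic_le
    _ ≤ ENNReal.ofReal (A + η) := ENNReal.ofReal_le_ofReal (by linarith)
    _ = kinetic γ + ENNReal.ofReal η := by
        rw [ENNReal.ofReal_add ENNReal.toReal_nonneg hη.le,
          ENNReal.ofReal_toReal (kinetic_lt_top_iff.2 hγ).ne]

end Regularisation

section Compactness

-- The diagonal sequence is eventually a subsequence of each of the successive extractions `Φ k`.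
lemma exists_strictMono_forall_tendsto {Y : Type*} (l : Y → Filter Y) (u : ℕ → ℕ → Y)
    (h : ∀ (k : ℕ) (φ : ℕ → ℕ), ∃ z, ∃ ψ : ℕ → ℕ, StrictMono ψ ∧
      Tendsto (fun n => u k (φ (ψ n))) atTop (l z)) :
    ∃ φ : ℕ → ℕ, StrictMono φ ∧ ∀ k, ∃ z, Tendsto (fun n => u k (φ n)) atTop (l z) := by
  choose z ψ hψ hz using h
  let Φ : ℕ → ℕ → ℕ := fun k => Nat.rec id (fun k φ => φ ∘ ψ k φ) k
  have hΦ_succ : ∀ k n, Φ (k + 1) n = Φ k (ψ k (Φ k) n) := fun _ _ => rfl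
  have hmono : ∀ k, StrictMono (Φ k) := by
    intro k
    induction k with
    | zero => exact strictMono_id
    | succ k ih => exact ih.comp (hψ _ _)
  have hsub : ∀ k n, k ≤ n → ∀ m, ∃ p, m ≤ p ∧ Φ n m = Φ k p := by
    intro k n hkn
    induction n, hkn using Nat.le_induction with
    | base => exact fun m => ⟨m, le_rfl, rfl⟩
    | succ n _ ih =>
      intro m
      obtain ⟨p, hp, hpΦ⟩ := ih (ψ n (Φ n) m)
      exact ⟨p, (hψ n (Φ n)).le_apply.trans hp, hpΦ⟩
  refine ⟨fun n => Φ n n, strictMono_nat_of_lt_succ fun n => ?_, fun k => ⟨z k (Φ k), ?_⟩⟩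
  · exact hmono n (n.lt_succ_self.trans_le (hψ n (Φ n)).le_apply)
  · refine tendsto_def.2 fun V hV => ?_
    obtain ⟨N, hN⟩ := eventually_atTop.1 (hz k (Φ k) hV)
    filter_upwards [eventually_ge_atTop (k + 1), eventually_ge_atTop N] with n hkn hNn
    obtain ⟨p, hp, hpΦ⟩ := hsub (k + 1) n hkn n
    rw [mem_preimage, hpΦ, hΦ_succ]
    exact hN p (hNn.trans hp)

variable {X : Type*} [MetricSpace X] {σ : X → Filter X} {u v : ℕ → X} {z w : X}

/-- Sequential compactness of bounded sets and sequential lower semicontinuity of the distance, for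
a notion of convergence given by filters `σ z` playing the role of neighbourhood filters. -/
structure IsWeakConvergence (σ : X → Filter X) : Prop where
  pure_le : ∀ z, pure z ≤ σ z
  compact : ∀ u : ℕ → X, Bornology.IsBounded (range u) →
    ∃ z : X, ∃ φ : ℕ → ℕ, StrictMono φ ∧ Tendsto (u ∘ φ) atTop (σ z)
  edist_le_liminf : ∀ (u v : ℕ → X) (z w : X), Tendsto u atTop (σ z) → Tendsto v atTop (σ w) →
    edist z w ≤ liminf (fun n => edist (u n) (v n)) atTop

/-- Sequential lower semicontinuity of `f` with respect to the filters `σ z`. -/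
def SeqLowerSemicontinuous {X : Type*} (σ : X → Filter X) (f : X → ℝ≥0∞) : Prop :=
  ∀ (u : ℕ → X) (z : X), Tendsto u atTop (σ z) → f z ≤ liminf (fun n => f (u n)) atTop

lemma IsWeakConvergence.tendsto_const (hσ : IsWeakConvergence σ) (z : X) :
    Tendsto (fun _ : ℕ => z) atTop (σ z) :=
  tendsto_const_pure.mono_right (hσ.pure_le z)

lemma IsWeakConvergence.dist_sq_le_of_tendsto (hσ : IsWeakConvergence σ)
    (hu : Tendsto u atTop (σ z)) (hv : Tendsto v atTop (σ w)) {l : Filter ℕ} [l.NeBot]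
    (hl : l ≤ atTop) {c : ℕ → ℝ} {C : ℝ} (hc : Tendsto c l (𝓝 C))
    (hle : ∀ n, dist (u n) (v n) ^ 2 ≤ c n) : dist z w ^ 2 ≤ C := by
  have hedist : edist z w ≤ ENNReal.ofReal √C :=
    calc edist z w ≤ liminf (fun n => edist (u n) (v n)) atTop :=
          hσ.edist_le_liminf u v z w hu hv
      _ ≤ liminf (fun n => edist (u n) (v n)) l := liminf_le_liminf_of_le hl
      _ ≤ liminf (fun n => ENNReal.ofReal √(c n)) l :=
          liminf_le_liminf <| Eventually.of_forall fun n => by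
            rw [edist_dist]
            exact ENNReal.ofReal_le_ofReal (Real.le_sqrt_of_sq_le (hle n))
      _ = ENNReal.ofReal √C := (ENNReal.tendsto_ofReal hc.sqrt).liminf_eq
  rw [edist_dist, ENNReal.ofReal_le_ofReal_iff (Real.sqrt_nonneg C)] at hedist
  exact (Real.le_sqrt dist_nonneg
    (ge_of_tendsto' hc fun n => (sq_nonneg _).trans (hle n))).1 hedist

lemma IsWeakConvergence.eq_of_tendsto (hσ : IsWeakConvergence σ) (hu : Tendsto u atTop (σ z))
    (hdist : Tendsto (fun n => dist (u n) w) atTop (𝓝 0)) : z = w := by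
  have hle := hσ.dist_sq_le_of_tendsto hu (hσ.tendsto_const w) le_rfl (hdist.pow 2) fun _ => le_rfl
  rw [zero_pow two_ne_zero] at hle
  exact dist_eq_zero.1 (sq_eq_zero_iff.1 (hle.antisymm (sq_nonneg _)))

lemma IsWeakConvergence.tendsto_of_tendsto (hσ : IsWeakConvergence σ)
    (hu : Tendsto u atTop (𝓝 z)) : Tendsto u atTop (σ z) := by
  refine tendsto_of_subseq_tendsto fun ns hns => ?_
  obtain ⟨w, φ, hφ, hw⟩ := hσ.compact (u ∘ ns)
    ((Metric.isBounded_range_of_tendsto u hu).subset (range_comp_subset_range ns u))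
  have hwz : w = z := hσ.eq_of_tendsto hw
    ((tendsto_iff_dist_tendsto_zero.1 hu).comp (hns.comp hφ.tendsto_atTop))
  exact ⟨φ, hwz ▸ hw⟩

lemma eq_of_forall_dist_sq_le {T : Type*} [TopologicalSpace T] {τ : ℕ → T} (hτ : DenseRange τ)
    {ρ : T → ℝ} {t : T} (hρ : Tendsto ρ (𝓝 t) (𝓝 0)) {p : ℕ → X}
    (hz : ∀ k, dist z (p k) ^ 2 ≤ ρ (τ k)) (hw : ∀ k, dist w (p k) ^ 2 ≤ ρ (τ k)) : z = w := by
  have hle : ∀ k, dist z w ^ 2 ≤ 4 * ρ (τ k) := fun k =>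
    calc dist z w ^ 2 ≤ (dist z (p k) + dist w (p k)) ^ 2 := by
          gcongr
          exact dist_triangle_right z w (p k)
      _ ≤ 4 * ρ (τ k) := by
          linarith [hz k, hw k, sq_nonneg (dist z (p k) - dist w (p k))]
  have : (𝓝[range τ] t).NeBot := mem_closure_iff_nhdsWithin_neBot.1 (hτ t)
  have hlim : Tendsto (fun s => 4 * ρ s) (𝓝[range τ] t) (𝓝 (4 * 0)) :=
    (hρ.mono_left nhdsWithin_le_nhds).const_mul 4
  have hzero : dist z w ^ 2 ≤ 4 * 0 := ge_of_tendsto hlim <|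
    eventually_mem_nhdsWithin.mono <| forall_mem_range.2 hle
  rw [mul_zero] at hzero
  exact dist_eq_zero.1 (sq_eq_zero_iff.1 (hzero.antisymm (sq_nonneg _)))

-- Arzelà–Ascoli: convergence along a dense sequence of parameters, obtained by a diagonal
-- extraction, propagates to all parameters by equicontinuity.
lemma IsWeakConvergence.exists_subseq_forall_tendsto (hσ : IsWeakConvergence σ) {T : Type*}
    [TopologicalSpace T] [TopologicalSpace.SeparableSpace T] {f : ℕ → T → X} {ρ : T → T → ℝ}
    (hρ : ∀ t, Tendsto (ρ t) (𝓝 t) (𝓝 0))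
    (hbdd : ∀ t, Bornology.IsBounded (range fun n => f n t))
    (hf : ∀ n s t, dist (f n s) (f n t) ^ 2 ≤ ρ s t) :
    ∃ (φ : ℕ → ℕ) (g : T → X), StrictMono φ ∧
      ∀ t, Tendsto (fun n => f (φ n) t) atTop (σ (g t)) := by
  rcases isEmpty_or_nonempty T with hT | hT
  · exact ⟨id, hT.elim, strictMono_id, hT.elim⟩
  have hcompact : ∀ (t : T) (ns : ℕ → ℕ), ∃ z, ∃ ψ : ℕ → ℕ, StrictMono ψ ∧
      Tendsto (fun n => f (ns (ψ n)) t) atTop (σ z) := fun t ns =>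
    hσ.compact (fun n => f (ns n) t)
      ((hbdd t).subset (range_comp_subset_range ns fun n => f n t))
  obtain ⟨τ, hτ⟩ := TopologicalSpace.exists_dense_seq T
  obtain ⟨φ, hφ, hτ_lim⟩ := exists_strictMono_forall_tendsto σ (fun k n => f n (τ k)) fun k =>
    hcompact (τ k)
  choose p hp using hτ_lim
  have hdist : ∀ t (ns : ℕ → ℕ), Tendsto ns atTop atTop → ∀ w,
      Tendsto (fun n => f (φ (ns n)) t) atTop (σ w) → ∀ k, dist w (p k) ^ 2 ≤ ρ t (τ k) :=
    fun t ns hns w hw k => hσ.dist_sq_le_of_tendsto hw ((hp k).comp hns) le_rfl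
      tendsto_const_nhds fun n => hf _ t (τ k)
  have hlim : ∀ t, ∃ z, Tendsto (fun n => f (φ n) t) atTop (σ z) := by
    intro t
    obtain ⟨z, ψ, hψ, hz⟩ := hcompact t φ
    refine ⟨z, tendsto_of_subseq_tendsto fun ns hns => ?_⟩
    obtain ⟨w, ψ', hψ', hw⟩ := hcompact t (φ ∘ ns)
    have hwz : w = z := eq_of_forall_dist_sq_le hτ (hρ t)
      (hdist t (ns ∘ ψ') (hns.comp hψ'.tendsto_atTop) w hw)
      (hdist t ψ hψ.tendsto_atTop z hz)
    exact ⟨ψ', hwz ▸ hw⟩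
  choose g hg using hlim
  exact ⟨φ, g, hφ, hg⟩

lemma SeqLowerSemicontinuous.lowerSemicontinuous (hσ : IsWeakConvergence σ) {f : X → ℝ≥0∞}
    (hf : SeqLowerSemicontinuous σ f) : LowerSemicontinuous f := by
  rw [lowerSemicontinuous_iff_isClosed_preimage]
  refine fun c => IsSeqClosed.isClosed fun u z hu hz => ?_
  calc f z ≤ liminf (fun n => f (u n)) atTop := hf u z (hσ.tendsto_of_tendsto hz)
    _ ≤ liminf (fun _ : ℕ => c) atTop := liminf_le_liminf (Eventually.of_forall hu)
    _ = c := liminf_const c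

lemma SeqLowerSemicontinuous.comp {X : Type*} {σ : X → Filter X} {f : X → ℝ≥0∞}
    {g : ℝ≥0∞ → ℝ≥0∞} (hf : SeqLowerSemicontinuous σ f) (hg : Monotone g) (hgc : Continuous g) :
    SeqLowerSemicontinuous σ fun z => g (f z) := fun u z hu =>
  (hg (hf u z hu)).trans_eq (hg.map_liminf_of_continuousAt _ hgc.continuousAt)

variable {γ : ℕ → ℝ → X} {ω : ℝ → X} {a b : ℝ}

lemma SeqLowerSemicontinuous.lintegral_le_liminf (hσ : IsWeakConvergence σ) {f : X → ℝ≥0∞}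
    (hf : SeqLowerSemicontinuous σ f) (hγ : ∀ n, ContinuousOn (γ n) (Ioo a b))
    (hω : ∀ t ∈ Ioo a b, Tendsto (fun n => γ n t) atTop (σ (ω t))) :
    ∫⁻ t in Ioo a b, f (ω t) ≤ liminf (fun n => ∫⁻ t in Ioo a b, f (γ n t)) atTop := by
  let _ : MeasurableSpace X := borel X
  have : BorelSpace X := ⟨rfl⟩
  calc ∫⁻ t in Ioo a b, f (ω t) ≤ ∫⁻ t in Ioo a b, liminf (fun n => f (γ n t)) atTop :=
        setLIntegral_mono' measurableSet_Ioo fun t ht => hf _ _ (hω t ht)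
    _ ≤ liminf (fun n => ∫⁻ t in Ioo a b, f (γ n t)) atTop :=
        lintegral_liminf_le' fun n => (hf.lowerSemicontinuous hσ).measurable.comp_aemeasurable
          ((hγ n).aemeasurable measurableSet_Ioo)

lemma SeqLowerSemicontinuous.fisher_le_liminf {E : X → EReal} (hσ : IsWeakConvergence σ)
    (hslope : SeqLowerSemicontinuous σ (slope E)) (hγ : ∀ n, ContinuousOn (γ n) (Ioo 0 1))
    (hω : ∀ t ∈ Ioo (0 : ℝ) 1, Tendsto (fun n => γ n t) atTop (σ (ω t))) :
    fisher E ω ≤ liminf (fun n => fisher E (γ n)) atTop := by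
  simp only [fisher, ← lintegral_const_mul' 2⁻¹ _ (by simp : (2⁻¹ : ℝ≥0∞) ≠ ⊤)]
  exact (hslope.comp (g := fun r => 2⁻¹ * r ^ 2) (fun _ _ hpq => by dsimp only; gcongr)
    ((ENNReal.continuous_const_mul (by simp)).comp (ENNReal.continuous_pow 2))).lintegral_le_liminf
    hσ hγ hω

lemma HasEnergyBound.le_of_mem {γ : ℝ → X} {e : ℝ → ℝ} (h : HasEnergyBound γ e a b) {s : ℝ}
    (hs : s ∈ Icc a b) : e s ∈ Icc (e a) (e b) :=
  have hab := hs.1.trans hs.2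
  ⟨h.monotoneOn ⟨le_rfl, hab⟩ hs hs.1, h.monotoneOn hs ⟨hab, le_rfl⟩ hs.2⟩

lemma HasEnergyBound.dist_sq_le_mul_abs {γ : ℝ → X} {e : ℝ → ℝ} (h : HasEnergyBound γ e a b)
    {s t : ℝ} (hs : s ∈ Icc a b) (ht : t ∈ Icc a b) :
    dist (γ s) (γ t) ^ 2 ≤ (e b - e a) * |t - s| := by
  wlog hst : s ≤ t generalizing s t
  · rw [dist_comm, abs_sub_comm]
    exact this ht hs (le_of_not_ge hst)
  rw [abs_of_nonneg (sub_nonneg.2 hst), mul_comm]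
  exact (h s t hs.1 hst ht.2).trans (mul_le_mul_of_nonneg_left
    (sub_le_sub (h.le_of_mem ht).2 (h.le_of_mem hs).1) (sub_nonneg.2 hst))

-- Limits along the hyperfilter exist for all times at once, without extracting subsequences.
lemma IsWeakConvergence.exists_hasEnergyBound (hσ : IsWeakConvergence σ) {e : ℕ → ℝ → ℝ} {L : ℝ}
    (hab : a ≤ b) (he : ∀ n, HasEnergyBound (γ n) (e n) a b) (hea : ∀ n, e n a = 0)
    (heb : Tendsto (fun n => e n b) atTop (𝓝 L))
    (hω : ∀ t ∈ Icc a b, Tendsto (fun n => γ n t) atTop (σ (ω t))) :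
    ∃ e', HasEnergyBound ω e' a b ∧ e' b - e' a = L := by
  have hyperfilter_le : (hyperfilter ℕ : Filter ℕ) ≤ atTop :=
    Nat.cofinite_eq_atTop ▸ hyperfilter_le_cofinite
  obtain ⟨B, hB⟩ := heb.bddAbove_range
  have hlim : ∀ t ∈ Icc a b, ∃ c,
      Tendsto (fun n => e n t) (hyperfilter ℕ : Filter ℕ) (𝓝 c) := by
    intro t ht
    have hmem : ∀ n, e n t ∈ Icc 0 B := fun n =>
      ⟨(hea n).symm.trans_le ((he n).le_of_mem ht).1,
        ((he n).le_of_mem ht).2.trans (hB (mem_range_self n))⟩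
    obtain ⟨c, -, hc⟩ := isCompact_Icc.ultrafilter_le_nhds
      ((hyperfilter ℕ).map fun n => e n t)
      (le_principal_iff.2 (mem_map.2 (Eventually.of_forall hmem)))
    exact ⟨c, hc⟩
  choose! e' he' using hlim
  have hleft : e' a = 0 := tendsto_nhds_unique (he' a ⟨le_rfl, hab⟩)
    (by simp only [hea]; exact tendsto_const_nhds)
  have hright := tendsto_nhds_unique (he' b ⟨hab, le_rfl⟩) (heb.mono_left hyperfilter_le)
  refine ⟨e', fun s t hs hst ht => ?_, by rw [hleft, hright, sub_zero]⟩
  have hs_mem : s ∈ Icc a b := ⟨hs, hst.trans ht⟩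
  have ht_mem : t ∈ Icc a b := ⟨hs.trans hst, ht⟩
  exact hσ.dist_sq_le_of_tendsto (hω s hs_mem) (hω t ht_mem) hyperfilter_le
    (((he' t ht_mem).sub (he' s hs_mem)).const_mul (t - s)) fun n => he n s t hs hst ht

lemma IsWeakConvergence.exists_limit_curve (hσ : IsWeakConvergence σ) {e : ℕ → ℝ → ℝ} {C : ℝ}
    {x : X} (hab : a ≤ b) (he : ∀ n, HasEnergyBound (γ n) (e n) a b)
    (hC : ∀ n, e n b - e n a ≤ C) (hx : ∀ n, γ n a = x) :
    ∃ (φ : ℕ → ℕ) (ω : ℝ → X), StrictMono φ ∧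
      ∀ t ∈ Icc a b, Tendsto (fun n => γ (φ n) t) atTop (σ (ω t)) := by
  have hdist : ∀ n, ∀ s t : Icc a b,
      dist (γ n s) (γ n t) ^ 2 ≤ C * |(t : ℝ) - s| := fun n s t =>
    ((he n).dist_sq_le_mul_abs s.2 t.2).trans (mul_le_mul_of_nonneg_right (hC n) (abs_nonneg _))
  have hbdd : ∀ t : Icc a b, Bornology.IsBounded (range fun n => γ n t) := by
    refine fun t => (Metric.isBounded_closedBall (x := x) (r := √(C * |a - t|))).subset ?_
    rintro _ ⟨n, rfl⟩
    exact Real.le_sqrt_of_sq_le (hx n ▸ hdist n t ⟨a, le_rfl, hab⟩)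
  obtain ⟨φ, g, hφ, hg⟩ := hσ.exists_subseq_forall_tendsto
    (f := fun n (t : Icc a b) => γ n t) (ρ := fun s t => C * |(t : ℝ) - s|)
    (fun s => Continuous.tendsto' (by fun_prop) _ _ (by simp)) hbdd hdist
  refine ⟨φ, IccExtend hab g, hφ, fun t ht => ?_⟩
  rw [IccExtend_of_mem hab g ht]
  exact hg ⟨t, ht⟩

lemma exists_joins_le_of_tendsto {E : X → EReal} (hσ : IsWeakConvergence σ)
    (hslope : SeqLowerSemicontinuous σ (slope E)) {x y : X} {A I : ℝ≥0∞}
    (hγ : ∀ n, IsAC2 (γ n)) (hx : ∀ n, γ n 0 = x) (hy : ∀ n, γ n 1 = y)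
    (hA : Tendsto (fun n => kinetic (γ n)) atTop (𝓝 A)) (hA_top : A ≠ ⊤)
    (hI : Tendsto (fun n => fisher E (γ n)) atTop (𝓝 I)) :
    ∃ ω, Joins ω x y ∧ kinetic ω ≤ A ∧ fisher E ω ≤ I := by
  have henergy : Tendsto (fun n => energy (γ n) 0 1) atTop (𝓝 (2 * A.toReal)) := by
    simp only [(hγ _).energy_eq]
    exact ((ENNReal.tendsto_toReal hA_top).comp hA).const_mul 2
  obtain ⟨C, hC⟩ := henergy.bddAbove_range
  obtain ⟨φ, ω, hφ, hω⟩ := hσ.exists_limit_curve zero_le_one (fun n => (hγ n).hasEnergyBound)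
    (fun n => by simpa only [energy_self, sub_zero] using hC (mem_range_self n)) hx
  obtain ⟨e, he, he_diff⟩ := hσ.exists_hasEnergyBound zero_le_one
    (fun n => (hγ (φ n)).hasEnergyBound) (fun n => energy_self _ _)
    (henergy.comp hφ.tendsto_atTop) hω
  have hendpoint : ∀ t ∈ Icc (0 : ℝ) 1, ∀ z, (∀ n, γ n t = z) → ω t = z := fun t ht z hz =>
    hσ.eq_of_tendsto (hω t ht) (by simp only [hz, dist_self]; exact tendsto_const_nhds)
  refine ⟨ω, ⟨he.continuousOn zero_le_one, hendpoint 0 (by simp) x hx, hendpoint 1 (by simp) y hy⟩,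
    ?_, ?_⟩
  · calc kinetic ω ≤ ENNReal.ofReal ((e 1 - e 0) / 2) := he.kinetic_le
      _ = A := by rw [he_diff, mul_div_cancel_left₀ _ two_ne_zero, ENNReal.ofReal_toReal hA_top]
  · rw [← (hI.comp hφ.tendsto_atTop).liminf_eq]
    exact hslope.fisher_le_liminf hσ
      (fun n => ((hγ (φ n)).1.continuousOn zero_le_one).mono Ioo_subset_Icc_self)
      fun t ht => hω t (Ioo_subset_Icc_self ht)

end Compactness

section Envelope

/-- Points of `P` minimising `p ↦ p.1 + s p.2`, where `F s` is the infimum. -/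
def optimal (P : Set (ℝ × ℝ)) (F : ℝ → ℝ) (s : ℝ) : Set (ℝ × ℝ) :=
  {p | p ∈ P ∧ p.1 + s * p.2 = F s}

/-- `F` is the lower envelope on `(0, ∞)` of the affine functions `s ↦ p.1 + s p.2`, `p ∈ P`, where
`P` is nonempty, contained in the positive quadrant, and closed up to domination. -/
structure IsEnvelope (P : Set (ℝ × ℝ)) (F : ℝ → ℝ) : Prop where
  nonempty : P.Nonempty
  nonneg : ∀ p ∈ P, 0 ≤ p
  closed : ∀ (p : ℕ → ℝ × ℝ) (q : ℝ × ℝ), (∀ n, p n ∈ P) → Tendsto p atTop (𝓝 q) →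
    ∃ r ∈ P, r ≤ q
  isGLB : ∀ s, 0 < s → IsGLB ((fun p : ℝ × ℝ => p.1 + s * p.2) '' P) (F s)

namespace IsEnvelope

variable {P : Set (ℝ × ℝ)} {F : ℝ → ℝ} {s t : ℝ} {p q : ℝ × ℝ}

lemma le (h : IsEnvelope P F) (hs : 0 < s) (hp : p ∈ P) : F s ≤ p.1 + s * p.2 :=
  (h.isGLB s hs).1 (mem_image_of_mem _ hp)

lemma mem_optimal_of_le (h : IsEnvelope P F) (hs : 0 < s) {r : ℝ × ℝ} (hr : r ∈ P) (hrq : r ≤ q)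
    (hq : ∀ p ∈ P, q.1 + s * q.2 ≤ p.1 + s * p.2) : q ∈ optimal P F s := by
  have hqr := hq r hr
  have hmul : s * r.2 ≤ s * q.2 := mul_le_mul_of_nonneg_left hrq.2 hs.le
  have hfst : r.1 = q.1 := by linarith [hrq.1]
  have hsnd : r.2 = q.2 := hrq.2.antisymm (le_of_mul_le_mul_left (by linarith) hs)
  obtain rfl : r = q := Prod.ext hfst hsnd
  exact ⟨hr, ((h.isGLB s hs).2 (forall_mem_image.2 hq)).antisymm (h.le hs hr)⟩

variable {σ δ : ℕ → ℝ} {u : ℕ → ℝ × ℝ}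

lemma exists_eventually_mem_Icc (h : IsEnvelope P F) (hs : 0 < s) (hσ : Tendsto σ atTop (𝓝 s))
    (hδ : Tendsto δ atTop (𝓝 0)) (hu : ∀ n, u n ∈ P)
    (hle : ∀ p ∈ P, ∀ n, (u n).1 + σ n * (u n).2 ≤ p.1 + σ n * p.2 + δ n) :
    ∃ c, ∀ᶠ n in atTop, u n ∈ Icc 0 c := by
  obtain ⟨p, hp⟩ := h.nonempty
  obtain ⟨M, hM⟩ := (((hσ.mul_const p.2).const_add p.1).add hδ).bddAbove_range
  refine ⟨(M, M / (s / 2)), ?_⟩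
  filter_upwards [hσ.eventually (lt_mem_nhds (half_lt_self hs))] with n hn
  obtain ⟨hfst, hsnd⟩ := Prod.le_def.1 (h.nonneg _ (hu n))
  have huM : (u n).1 + σ n * (u n).2 ≤ M := (hle p hp n).trans (hM (mem_range_self n))
  have hmul : s / 2 * (u n).2 ≤ σ n * (u n).2 := mul_le_mul_of_nonneg_right hn.le hsnd
  have hmul_nonneg : 0 ≤ s / 2 * (u n).2 := mul_nonneg (half_pos hs).le hsnd
  simp only [Prod.fst_zero] at hfst
  refine ⟨h.nonneg _ (hu n), by dsimp only; linarith, ?_⟩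
  rw [le_div_iff₀' (half_pos hs)]
  linarith

lemma exists_subseq_tendsto (h : IsEnvelope P F) (hs : 0 < s) (hσ : Tendsto σ atTop (𝓝 s))
    (hδ : Tendsto δ atTop (𝓝 0)) (hu : ∀ n, u n ∈ P)
    (hle : ∀ p ∈ P, ∀ n, (u n).1 + σ n * (u n).2 ≤ p.1 + σ n * p.2 + δ n) :
    ∃ q ∈ optimal P F s, ∃ φ : ℕ → ℕ, StrictMono φ ∧ Tendsto (u ∘ φ) atTop (𝓝 q) := by
  obtain ⟨c, hc⟩ := h.exists_eventually_mem_Icc hs hσ hδ hu hle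
  obtain ⟨q, -, φ, hφ, hq⟩ := isCompact_Icc.tendsto_subseq' hc.frequently
  obtain ⟨r, hr, hrq⟩ := h.closed (u ∘ φ) q (fun n => hu _) hq
  have hσφ : Tendsto (σ ∘ φ) atTop (𝓝 s) := hσ.comp hφ.tendsto_atTop
  refine ⟨q, h.mem_optimal_of_le hs hr hrq fun p hp => ?_, φ, hφ, hq⟩
  have hlim : Tendsto (fun n => p.1 + σ (φ n) * p.2 + δ (φ n)) atTop (𝓝 (p.1 + s * p.2)) := by
    simpa only [add_zero, Function.comp_apply] using
      ((hσφ.mul_const p.2).const_add p.1).add (hδ.comp hφ.tendsto_atTop)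
  exact le_of_tendsto_of_tendsto' (hq.fst_nhds.add (hσφ.mul hq.snd_nhds)) hlim
    fun n => hle p hp (φ n)

lemma exists_subseq_tendsto_of_mem_optimal (h : IsEnvelope P F) (hs : 0 < s)
    (hσ_pos : ∀ n, 0 < σ n) (hσ : Tendsto σ atTop (𝓝 s)) (hu : ∀ n, u n ∈ optimal P F (σ n)) :
    ∃ q ∈ optimal P F s, ∃ φ : ℕ → ℕ, StrictMono φ ∧ Tendsto (u ∘ φ) atTop (𝓝 q) :=
  h.exists_subseq_tendsto hs hσ tendsto_const_nhds (fun n => (hu n).1) fun p hp n => by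
    rw [(hu n).2, add_zero]
    exact h.le (hσ_pos n) hp

lemma optimal_nonempty (h : IsEnvelope P F) (hs : 0 < s) : (optimal P F s).Nonempty := by
  have happrox : ∀ n : ℕ, ∃ p ∈ P, p.1 + s * p.2 < F s + 1 / ((n : ℝ) + 1) := fun n => by
    obtain ⟨_, ⟨p, hp, rfl⟩, -, hlt⟩ :=
      (h.isGLB s hs).exists_between (lt_add_of_pos_right (F s) (Nat.one_div_pos_of_nat (n := n)))
    exact ⟨p, hp, hlt⟩
  choose u hu hlt using happrox
  obtain ⟨q, hq, -⟩ := h.exists_subseq_tendsto hs tendsto_const_nhds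
    tendsto_one_div_add_atTop_nhds_zero_nat hu fun p hp n =>
      (hlt n).le.trans (add_le_add_left (h.le hs hp) _)
  exact ⟨q, hq⟩

lemma isCompact_optimal (h : IsEnvelope P F) (hs : 0 < s) : IsCompact (optimal P F s) :=
  IsSeqCompact.isCompact fun _ hu =>
    h.exists_subseq_tendsto_of_mem_optimal hs (fun _ => hs) tendsto_const_nhds hu

lemma exists_isMinOn_snd (h : IsEnvelope P F) (hs : 0 < s) :
    ∃ q ∈ optimal P F s, IsMinOn Prod.snd (optimal P F s) q :=
  (h.isCompact_optimal hs).exists_isMinOn (h.optimal_nonempty hs) continuous_snd.continuousOn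

lemma exists_isMaxOn_snd (h : IsEnvelope P F) (hs : 0 < s) :
    ∃ q ∈ optimal P F s, IsMaxOn Prod.snd (optimal P F s) q :=
  (h.isCompact_optimal hs).exists_isMaxOn (h.optimal_nonempty hs) continuous_snd.continuousOn

lemma eventually_optimal_subset (h : IsEnvelope P F) (hs : 0 < s) {U : Set (ℝ × ℝ)}
    (hU : IsOpen U) (hsub : optimal P F s ⊆ U) : ∀ᶠ t in 𝓝 s, optimal P F t ⊆ U := by
  by_contra hcon
  obtain ⟨σ, hσ, hσU⟩ := exists_seq_forall_of_frequently
    ((not_eventually.1 hcon).and_eventually (lt_mem_nhds hs))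
  choose u hu huU using fun n => not_subset.1 (hσU n).1
  obtain ⟨q, hq, φ, -, hlim⟩ :=
    h.exists_subseq_tendsto_of_mem_optimal hs (fun n => (hσU n).2) hσ hu
  exact hU.isClosed_compl.mem_of_tendsto hlim (Eventually.of_forall fun n => huU (φ n)) (hsub hq)

lemma slope_mem_Icc (h : IsEnvelope P F) (hs : 0 < s) (hst : s < t) (hp : p ∈ optimal P F s)
    (hq : q ∈ optimal P F t) : _root_.slope F s t ∈ Icc q.2 p.2 := by
  have hFs := h.le hs hq.1
  have hFt := h.le (hs.trans hst) hp.1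
  rw [slope_def_field, mem_Icc, le_div_iff₀ (sub_pos.2 hst), div_le_iff₀ (sub_pos.2 hst)]
  constructor
  · linarith [hq.2]
  · linarith [hp.2]

lemma tendsto_nhdsGT (h : IsEnvelope P F) (hs : 0 < s) (hq : IsMinOn Prod.snd (optimal P F s) q)
    {g : ℝ → ℝ} (hg : ∀ t, s < t → ∃ p ∈ optimal P F t, g t ∈ Icc p.2 q.2) :
    Tendsto g (𝓝[>] s) (𝓝 q.2) := by
  refine tendsto_order.2 ⟨fun c hc => ?_, fun c hc => ?_⟩
  · filter_upwards [(h.eventually_optimal_subset hs (isOpen_lt continuous_const continuous_snd)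
      fun r hr => hc.trans_le (hq hr)).filter_mono nhdsWithin_le_nhds,
      self_mem_nhdsWithin] with t ht hst
    obtain ⟨p, hp, hpg⟩ := hg t hst
    exact (ht hp).trans_le hpg.1
  · filter_upwards [self_mem_nhdsWithin] with t hst
    obtain ⟨p, -, hpg⟩ := hg t hst
    exact hpg.2.trans_lt hc

lemma tendsto_nhdsLT (h : IsEnvelope P F) (hs : 0 < s) (hq : IsMaxOn Prod.snd (optimal P F s) q)
    {g : ℝ → ℝ} (hg : ∀ t, 0 < t → t < s → ∃ p ∈ optimal P F t, g t ∈ Icc q.2 p.2) :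
    Tendsto g (𝓝[<] s) (𝓝 q.2) := by
  refine tendsto_order.2 ⟨fun c hc => ?_, fun c hc => ?_⟩
  · filter_upwards [Ioo_mem_nhdsLT hs] with t ht
    obtain ⟨p, -, hpg⟩ := hg t ht.1 ht.2
    exact hc.trans_le hpg.1
  · filter_upwards [(h.eventually_optimal_subset hs (isOpen_lt continuous_snd continuous_const)
      fun r hr => (hq hr).trans_lt hc).filter_mono nhdsWithin_le_nhds,
      Ioo_mem_nhdsLT hs] with t ht hts
    obtain ⟨p, hp, hpg⟩ := hg t hts.1 hts.2
    exact hpg.2.trans_lt (ht hp)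

lemma hasDerivWithinAt_Ici (h : IsEnvelope P F) (hs : 0 < s) (hq : q ∈ optimal P F s)
    (hmin : IsMinOn Prod.snd (optimal P F s) q) : HasDerivWithinAt F q.2 (Ici s) s := by
  rw [hasDerivWithinAt_iff_tendsto_slope, Ici_sdiff_left]
  refine h.tendsto_nhdsGT hs hmin fun t hst => ?_
  obtain ⟨p, hp⟩ := h.optimal_nonempty (hs.trans hst)
  exact ⟨p, hp, h.slope_mem_Icc hs hst hq hp⟩

lemma hasDerivWithinAt_Iic (h : IsEnvelope P F) (hs : 0 < s) (hq : q ∈ optimal P F s)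
    (hmax : IsMaxOn Prod.snd (optimal P F s) q) : HasDerivWithinAt F q.2 (Iic s) s := by
  rw [hasDerivWithinAt_iff_tendsto_slope, Iic_sdiff_right]
  refine h.tendsto_nhdsLT hs hmax fun t ht hts => ?_
  obtain ⟨p, hp⟩ := h.optimal_nonempty ht
  exact ⟨p, hp, slope_comm F t s ▸ h.slope_mem_Icc ht hts hp hq⟩

lemma continuousWithinAt_derivWithin_Ici (h : IsEnvelope P F) (hs : 0 < s) :
    ContinuousWithinAt (fun t => derivWithin F (Ici t) t) (Ici s) s := by
  obtain ⟨q, hq, hmin⟩ := h.exists_isMinOn_snd hs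
  rw [← continuousWithinAt_Ioi_iff_Ici, ContinuousWithinAt,
    (h.hasDerivWithinAt_Ici hs hq hmin).derivWithin (uniqueDiffWithinAt_Ici s)]
  refine h.tendsto_nhdsGT hs hmin fun t hst => ?_
  obtain ⟨p, hp, hpmin⟩ := h.exists_isMinOn_snd (hs.trans hst)
  have hpq := h.slope_mem_Icc hs hst hq hp
  rw [(h.hasDerivWithinAt_Ici (hs.trans hst) hp hpmin).derivWithin (uniqueDiffWithinAt_Ici t)]
  exact ⟨p, hp, le_rfl, hpq.1.trans hpq.2⟩

lemma continuousWithinAt_derivWithin_Iic (h : IsEnvelope P F) (hs : 0 < s) :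
    ContinuousWithinAt (fun t => derivWithin F (Iic t) t) (Iic s) s := by
  obtain ⟨q, hq, hmax⟩ := h.exists_isMaxOn_snd hs
  rw [← continuousWithinAt_Iio_iff_Iic, ContinuousWithinAt,
    (h.hasDerivWithinAt_Iic hs hq hmax).derivWithin (uniqueDiffWithinAt_Iic s)]
  refine h.tendsto_nhdsLT hs hmax fun t ht hts => ?_
  obtain ⟨p, hp, hpmax⟩ := h.exists_isMaxOn_snd ht
  have hpq := h.slope_mem_Icc ht hts hp hq
  rw [(h.hasDerivWithinAt_Iic ht hp hpmax).derivWithin (uniqueDiffWithinAt_Iic t)]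
  exact ⟨p, hp, hpq.1.trans hpq.2, le_rfl⟩

end IsEnvelope

variable {F : ℝ → ℝ} {ε m : ℝ}

lemma hasDerivWithinAt_comp_sq_Ici (hε : 0 ≤ ε)
    (h : HasDerivWithinAt F m (Ici (ε ^ 2)) (ε ^ 2)) :
    HasDerivWithinAt (fun t => F (t ^ 2)) (2 * ε * m) (Ici ε) ε := by
  have hsq : HasDerivWithinAt (fun t : ℝ => t ^ 2) (2 * ε) (Ici ε) ε := by
    simpa using (hasDerivAt_pow 2 ε).hasDerivWithinAt
  rw [mul_comm]
  exact HasDerivWithinAt.comp (h := fun t : ℝ => t ^ 2) ε h hsq fun t ht =>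
    pow_le_pow_left₀ hε ht 2

lemma hasDerivWithinAt_comp_sq_Iic (hε : 0 < ε)
    (h : HasDerivWithinAt F m (Iic (ε ^ 2)) (ε ^ 2)) :
    HasDerivWithinAt (fun t => F (t ^ 2)) (2 * ε * m) (Iic ε) ε := by
  have hsq : HasDerivWithinAt (fun t : ℝ => t ^ 2) (2 * ε) (Icc 0 ε) ε := by
    simpa using (hasDerivAt_pow 2 ε).hasDerivWithinAt
  rw [mul_comm]
  exact (HasDerivWithinAt.comp (h := fun t : ℝ => t ^ 2) ε h hsq fun t ht =>
    pow_le_pow_left₀ ht.1 ht.2 2).mono_of_mem_nhdsWithin (Icc_mem_nhdsLE hε)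

lemma IsEnvelope.continuousWithinAt_derivWithin_comp_sq_Ici {P : Set (ℝ × ℝ)}
    (h : IsEnvelope P F) (hε : 0 < ε) :
    ContinuousWithinAt (fun t => derivWithin (fun ε' => F (ε' ^ 2)) (Ici t) t) (Ici ε) ε := by
  have hderiv : ∀ t ∈ Ici ε, derivWithin (fun ε' => F (ε' ^ 2)) (Ici t) t =
      2 * t * derivWithin F (Ici (t ^ 2)) (t ^ 2) := fun t ht => by
    have ht_pos : 0 < t := hε.trans_le ht
    obtain ⟨q, hq, hmin⟩ := h.exists_isMinOn_snd (pow_pos ht_pos 2)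
    exact (hasDerivWithinAt_comp_sq_Ici ht_pos.le (h.hasDerivWithinAt_Ici (pow_pos ht_pos 2) hq
      hmin).differentiableWithinAt.hasDerivWithinAt).derivWithin (uniqueDiffWithinAt_Ici t)
  refine ContinuousWithinAt.congr_of_mem ?_ hderiv self_mem_Ici
  exact ContinuousWithinAt.mul (by fun_prop) <|
    ContinuousWithinAt.comp (f := fun t : ℝ => t ^ 2)
      (h.continuousWithinAt_derivWithin_Ici (pow_pos hε 2))
      (continuous_pow 2).continuousWithinAt fun t ht => pow_le_pow_left₀ hε.le ht 2

lemma IsEnvelope.continuousWithinAt_derivWithin_comp_sq_Iic {P : Set (ℝ × ℝ)}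
    (h : IsEnvelope P F) (hε : 0 < ε) :
    ContinuousWithinAt (fun t => derivWithin (fun ε' => F (ε' ^ 2)) (Iic t) t) (Iic ε) ε := by
  have hderiv : ∀ t ∈ Ioc 0 ε, derivWithin (fun ε' => F (ε' ^ 2)) (Iic t) t =
      2 * t * derivWithin F (Iic (t ^ 2)) (t ^ 2) := fun t ht => by
    obtain ⟨q, hq, hmax⟩ := h.exists_isMaxOn_snd (pow_pos ht.1 2)
    exact (hasDerivWithinAt_comp_sq_Iic ht.1 (h.hasDerivWithinAt_Iic (pow_pos ht.1 2) hq
      hmax).differentiableWithinAt.hasDerivWithinAt).derivWithin (uniqueDiffWithinAt_Iic t)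
  refine ContinuousWithinAt.mono_of_mem_nhdsWithin ?_ (Ioc_mem_nhdsLE hε)
  refine ContinuousWithinAt.congr_of_mem ?_ hderiv ⟨hε, le_rfl⟩
  exact ContinuousWithinAt.mul (by fun_prop) <|
    ContinuousWithinAt.comp (f := fun t : ℝ => t ^ 2)
      (h.continuousWithinAt_derivWithin_Iic (pow_pos hε 2))
      (continuous_pow 2).continuousWithinAt fun t ht => pow_le_pow_left₀ ht.1.le ht.2 2

lemma absolutelyContinuousOnInterval_of_right_deriv_nonneg {g g' : ℝ → ℝ} {a b : ℝ} (hab : a ≤ b)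
    (hcont : ContinuousOn g (Icc a b))
    (hderiv : ∀ t ∈ Ioo a b, HasDerivWithinAt g (g' t) (Ioi t) t)
    (hnonneg : ∀ t ∈ Ioo a b, 0 ≤ g' t) : AbsolutelyContinuousOnInterval g a b := by
  have hint : IntervalIntegrable g' volume a b :=
    (intervalIntegrable_iff_integrableOn_Ioc_of_le hab).2
      (intervalIntegral.integrableOn_deriv_right_of_nonneg hcont hderiv hnonneg)
  have hftc : ∀ t ∈ uIcc a b, ∫ r in a..t, g' r = g t - g a := fun t ht => by
    rw [uIcc_of_le hab] at ht
    refine intervalIntegral.integral_eq_sub_of_hasDeriv_right_of_le ht.1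
      (hcont.mono (Icc_subset_Icc_right ht.2)) (fun r hr => hderiv r ⟨hr.1, hr.2.trans_le ht.2⟩)
      (hint.mono_set (uIcc_subset_uIcc_left (Icc_subset_uIcc ht)))
  refine absolutelyContinuousOnInterval_of_dist_le
    (hint.absolutelyContinuousOnInterval_intervalIntegral (c := a) left_mem_uIcc) ?_
  intro s hs t ht
  rw [hftc s hs, hftc t ht, dist_sub_right]

end Envelope

section Cost

variable {X : Type*} [MetricSpace X] {E : X → EReal} {x y : X}

/-- The cost as a function of `s = ε²`. -/
noncomputable def costSq (E : X → EReal) (x y : X) (s : ℝ) : ℝ≥0∞ :=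
  ⨅ (γ : ℝ → X) (_ : Joins γ x y), (kinetic γ + ENNReal.ofReal s * fisher E γ)

/-- Curves from `x` to `y` with finite kinetic energy and Fisher information. -/
def regularCurves (E : X → EReal) (x y : X) : Set (ℝ → X) :=
  {γ | Joins γ x y ∧ IsAC2 γ ∧ fisher E γ < ⊤}

/-- Kinetic energy and Fisher information as a point of the plane, meaningful when both are
finite. -/
noncomputable def energyPair (E : X → EReal) (γ : ℝ → X) : ℝ × ℝ :=
  ((kinetic γ).toReal, (fisher E γ).toReal)

variable {γ ω : ℝ → X} {s ε : ℝ}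

lemma IsAC2.joins (h : IsAC2 γ) (h0 : γ 0 = x) (h1 : γ 1 = y) : Joins γ x y :=
  ⟨h.1.continuousOn zero_le_one, h0, h1⟩

lemma energyPair_nonneg (E : X → EReal) (γ : ℝ → X) : 0 ≤ energyPair E γ :=
  ⟨ENNReal.toReal_nonneg, ENNReal.toReal_nonneg⟩

lemma ofReal_energyPair (h : γ ∈ regularCurves E x y) (hs : 0 ≤ s) :
    ENNReal.ofReal ((energyPair E γ).1 + s * (energyPair E γ).2) =
      kinetic γ + ENNReal.ofReal s * fisher E γ := by
  obtain ⟨hkinetic, hfisher⟩ := energyPair_nonneg E γ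
  rw [ENNReal.ofReal_add hkinetic (mul_nonneg hs hfisher), ENNReal.ofReal_mul hs, energyPair,
    ENNReal.ofReal_toReal (kinetic_lt_top_iff.2 h.2.1).ne, ENNReal.ofReal_toReal h.2.2.ne]

lemma costSq_le_ofReal (h : γ ∈ regularCurves E x y) (hs : 0 ≤ s) :
    costSq E x y s ≤ ENNReal.ofReal ((energyPair E γ).1 + s * (energyPair E γ).2) :=
  (iInf₂_le γ h.1).trans_eq (ofReal_energyPair h hs).symm

lemma costSq_lt_top (hne : (regularCurves E x y).Nonempty) (hs : 0 ≤ s) : costSq E x y s < ⊤ :=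
  let ⟨_, hγ⟩ := hne
  (costSq_le_ofReal hγ hs).trans_lt ENNReal.ofReal_lt_top

lemma toReal_costSq_le (h : γ ∈ regularCurves E x y) (hs : 0 ≤ s) :
    (costSq E x y s).toReal ≤ (energyPair E γ).1 + s * (energyPair E γ).2 :=
  ENNReal.toReal_le_of_le_ofReal
    (add_nonneg (energyPair_nonneg E γ).1 (mul_nonneg hs (energyPair_nonneg E γ).2))
    (costSq_le_ofReal h hs)

lemma costSq_mono (E : X → EReal) (x y : X) : Monotone (costSq E x y) := fun s t hst =>
  iInf₂_mono fun γ _ => by gcongr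

lemma mem_regularCurves_of_lt_top (h : Joins γ x y) (hs : 0 < s)
    (hlt : kinetic γ + ENNReal.ofReal s * fisher E γ < ⊤) : γ ∈ regularCurves E x y := by
  obtain ⟨hkinetic, hfisher⟩ := ENNReal.add_lt_top.1 hlt
  exact ⟨h, kinetic_lt_top_iff.1 hkinetic,
    ENNReal.lt_top_of_mul_ne_top_right hfisher.ne (ENNReal.ofReal_pos.2 hs).ne'⟩

lemma regularCurves_nonempty (hε : 0 < ε) (h : cost E x y ε < ⊤) :
    (regularCurves E x y).Nonempty := by
  obtain ⟨γ, hγ, hlt⟩ : ∃ γ, ∃ _ : Joins γ x y, action E ε γ < ⊤ := by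
    simpa only [cost, iInf_lt_iff] using h
  exact ⟨γ, mem_regularCurves_of_lt_top hγ (pow_pos hε 2) hlt⟩

lemma exists_energyPair_le_of_tendsto {σ : X → Filter X} (hσ : IsWeakConvergence σ)
    (hslope : SeqLowerSemicontinuous σ (slope E)) {γ : ℕ → ℝ → X}
    (hγ : ∀ n, γ n ∈ regularCurves E x y) {q : ℝ × ℝ}
    (hq : Tendsto (fun n => energyPair E (γ n)) atTop (𝓝 q)) :
    ∃ ω ∈ regularCurves E x y, energyPair E ω ≤ q := by
  have hq_nonneg : 0 ≤ q := ge_of_tendsto' hq fun n => energyPair_nonneg E (γ n)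
  have hkinetic : Tendsto (fun n => kinetic (γ n)) atTop (𝓝 (ENNReal.ofReal q.1)) :=
    (ENNReal.tendsto_ofReal hq.fst_nhds).congr fun n =>
      ENNReal.ofReal_toReal (kinetic_lt_top_iff.2 (hγ n).2.1).ne
  have hfisher : Tendsto (fun n => fisher E (γ n)) atTop (𝓝 (ENNReal.ofReal q.2)) :=
    (ENNReal.tendsto_ofReal hq.snd_nhds).congr fun n => ENNReal.ofReal_toReal (hγ n).2.2.ne
  obtain ⟨ω, hω, hω_kinetic, hω_fisher⟩ := exists_joins_le_of_tendsto hσ hslope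
    (fun n => (hγ n).2.1) (fun n => (hγ n).1.2.1) (fun n => (hγ n).1.2.2) hkinetic
    ENNReal.ofReal_ne_top hfisher
  exact ⟨ω, ⟨hω, kinetic_lt_top_iff.1 (hω_kinetic.trans_lt ENNReal.ofReal_lt_top),
    hω_fisher.trans_lt ENNReal.ofReal_lt_top⟩,
    ENNReal.toReal_le_of_le_ofReal hq_nonneg.1 hω_kinetic,
    ENNReal.toReal_le_of_le_ofReal hq_nonneg.2 hω_fisher⟩

lemma isGLB_toReal_costSq (hne : (regularCurves E x y).Nonempty) (hs : 0 < s) :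
    IsGLB ((fun p : ℝ × ℝ => p.1 + s * p.2) '' (energyPair E '' regularCurves E x y))
      (costSq E x y s).toReal := by
  refine ⟨forall_mem_image.2 <| forall_mem_image.2 fun γ hγ => toReal_costSq_le hγ hs.le,
    fun c hc => ?_⟩
  rw [← ENNReal.ofReal_le_iff_le_toReal (costSq_lt_top hne hs.le).ne]
  refine le_iInf₂ fun γ hγ => ?_
  rcases eq_top_or_lt_top (kinetic γ + ENNReal.ofReal s * fisher E γ) with htop | hlt
  · exact htop ▸ le_top
  · have hγ_mem := mem_regularCurves_of_lt_top hγ hs hlt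
    rw [← ofReal_energyPair hγ_mem hs.le]
    exact ENNReal.ofReal_le_ofReal (hc (mem_image_of_mem _ (mem_image_of_mem _ hγ_mem)))

lemma isEnvelope_costSq {σ : X → Filter X} (hσ : IsWeakConvergence σ)
    (hslope : SeqLowerSemicontinuous σ (slope E)) (hne : (regularCurves E x y).Nonempty) :
    IsEnvelope (energyPair E '' regularCurves E x y) (fun s => (costSq E x y s).toReal) where
  nonempty := hne.image _
  nonneg := forall_mem_image.2 fun γ _ => energyPair_nonneg E γ
  closed p q hp hq := by
    choose γ hγ hγp using hp
    obtain ⟨ω, hω, hle⟩ := exists_energyPair_le_of_tendsto hσ hslope hγ (by simpa only [hγp])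
    exact ⟨_, mem_image_of_mem _ hω, hle⟩
  isGLB _ hs := isGLB_toReal_costSq hne hs

lemma mem_minimizers_iff (hne : (regularCurves E x y).Nonempty) (hε : 0 < ε) :
    γ ∈ minimizers E x y ε ↔ γ ∈ regularCurves E x y ∧
      energyPair E γ ∈ optimal (energyPair E '' regularCurves E x y)
        (fun s => (costSq E x y s).toReal) (ε ^ 2) := by
  have hlt : cost E x y ε < ⊤ := costSq_lt_top hne (sq_nonneg ε)
  have haction : γ ∈ regularCurves E x y →
      ((energyPair E γ).1 + ε ^ 2 * (energyPair E γ).2 = (costSq E x y (ε ^ 2)).toReal ↔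
        action E ε γ = cost E x y ε) := fun hγ => by
    have hsum_nonneg : 0 ≤ (energyPair E γ).1 + ε ^ 2 * (energyPair E γ).2 :=
      add_nonneg (energyPair_nonneg E γ).1 (mul_nonneg (sq_nonneg ε) (energyPair_nonneg E γ).2)
    rw [action, ← ofReal_energyPair hγ (sq_nonneg ε), ← ENNReal.toReal_eq_toReal_iff'
      ENNReal.ofReal_ne_top hlt.ne, ENNReal.toReal_ofReal hsum_nonneg]
    rfl
  constructor
  · rintro ⟨hAC, h0, h1, hmin⟩
    have hγ := mem_regularCurves_of_lt_top (hAC.joins h0 h1) (pow_pos hε 2) (hmin ▸ hlt)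
    exact ⟨hγ, mem_image_of_mem _ hγ, (haction hγ).2 hmin⟩
  · rintro ⟨hγ, -, hopt⟩
    exact ⟨hγ.2.1, hγ.1.2.1, hγ.1.2.2, (haction hγ).1 hopt⟩

lemma exists_mem_minimizers_of_mem_optimal (hne : (regularCurves E x y).Nonempty) (hε : 0 < ε)
    {q : ℝ × ℝ} (hq : q ∈ optimal (energyPair E '' regularCurves E x y)
      (fun s => (costSq E x y s).toReal) (ε ^ 2)) :
    ∃ ω ∈ minimizers E x y ε, energyPair E ω = q := by
  obtain ⟨ω, hω, rfl⟩ := hq.1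
  exact ⟨ω, (mem_minimizers_iff hne hε).2 ⟨hω, hq⟩, rfl⟩

lemma exists_isMaxOn_fisher_hasDerivWithinAt {σ : X → Filter X} (hσ : IsWeakConvergence σ)
    (hslope : SeqLowerSemicontinuous σ (slope E)) (hne : (regularCurves E x y).Nonempty)
    (hε : 0 < ε) :
    ∃ ω ∈ minimizers E x y ε, IsMaxOn (fisher E) (minimizers E x y ε) ω ∧ fisher E ω < ⊤ ∧
      HasDerivWithinAt (fun ε' => (cost E x y ε').toReal) (2 * ε * (fisher E ω).toReal)
        (Iic ε) ε := by
  have henv := isEnvelope_costSq hσ hslope hne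
  obtain ⟨q, hq, hmax⟩ := henv.exists_isMaxOn_snd (pow_pos hε 2)
  have hderiv := hasDerivWithinAt_comp_sq_Iic hε (henv.hasDerivWithinAt_Iic (pow_pos hε 2) hq hmax)
  obtain ⟨ω, hω, rfl⟩ := exists_mem_minimizers_of_mem_optimal hne hε hq
  have hω_top := ((mem_minimizers_iff hne hε).1 hω).1.2.2
  refine ⟨ω, hω, fun γ hγ => ?_, hω_top, hderiv⟩
  obtain ⟨hγ_mem, hγ_opt⟩ := (mem_minimizers_iff hne hε).1 hγ
  exact (ENNReal.toReal_le_toReal hγ_mem.2.2.ne hω_top.ne).1 (hmax hγ_opt)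

lemma exists_isMinOn_fisher_hasDerivWithinAt {σ : X → Filter X} (hσ : IsWeakConvergence σ)
    (hslope : SeqLowerSemicontinuous σ (slope E)) (hne : (regularCurves E x y).Nonempty)
    (hε : 0 < ε) :
    ∃ ω ∈ minimizers E x y ε, IsMinOn (fisher E) (minimizers E x y ε) ω ∧ fisher E ω < ⊤ ∧
      HasDerivWithinAt (fun ε' => (cost E x y ε').toReal) (2 * ε * (fisher E ω).toReal)
        (Ici ε) ε := by
  have henv := isEnvelope_costSq hσ hslope hne
  obtain ⟨q, hq, hmin⟩ := henv.exists_isMinOn_snd (pow_pos hε 2)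
  have hderiv := hasDerivWithinAt_comp_sq_Ici hε.le
    (henv.hasDerivWithinAt_Ici (pow_pos hε 2) hq hmin)
  obtain ⟨ω, hω, rfl⟩ := exists_mem_minimizers_of_mem_optimal hne hε hq
  have hω_top := ((mem_minimizers_iff hne hε).1 hω).1.2.2
  refine ⟨ω, hω, fun γ hγ => ?_, hω_top, hderiv⟩
  obtain ⟨hγ_mem, hγ_opt⟩ := (mem_minimizers_iff hne hε).1 hγ
  exact (ENNReal.toReal_le_toReal hω_top.ne hγ_mem.2.2.ne).1 (hmin hγ_opt)

-- A near-minimiser of the kinetic energy may have infinite Fisher information; its regularisation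
-- by the flow of `E` does not.
lemma exists_mem_regularCurves_kinetic_le (hE : IsAdmissibleEnergy E)
    (hne : (regularCurves E x y).Nonempty) {η : ℝ} (hη : 0 < η) :
    ∃ γ ∈ regularCurves E x y, (energyPair E γ).1 ≤ (costSq E x y 0).toReal + η := by
  have hcost_top := costSq_lt_top hne le_rfl
  obtain ⟨γ, hγ, hγ_lt⟩ :
      ∃ γ, ∃ _ : Joins γ x y, kinetic γ < costSq E x y 0 + ENNReal.ofReal (η / 2) := by
    simpa [costSq, iInf_lt_iff] using
      ENNReal.lt_add_right hcost_top.ne (ENNReal.ofReal_pos.2 (half_pos hη)).ne'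
  have hγ_AC : IsAC2 γ := kinetic_lt_top_iff.1 hγ_lt.lt_top
  obtain ⟨ω, hω⟩ := hne
  obtain ⟨hx, hy⟩ := lt_top_and_lt_top_of_fisher hE hω.2.1 hω.2.2
  rw [hω.1.2.1, ← hγ.2.1] at hx
  rw [hω.1.2.2, ← hγ.2.2] at hy
  obtain ⟨w, hw, hw_kinetic, hw_fisher⟩ :=
    exists_joins_fisher_lt_top hE hγ_AC hx hy (half_pos hη)
  rw [hγ.2.1, hγ.2.2] at hw
  have hw_le : kinetic w ≤ ENNReal.ofReal ((costSq E x y 0).toReal + η) :=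
    calc kinetic w
        ≤ costSq E x y 0 + ENNReal.ofReal (η / 2) + ENNReal.ofReal (η / 2) :=
          hw_kinetic.trans (add_le_add_left hγ_lt.le _)
      _ = ENNReal.ofReal ((costSq E x y 0).toReal + η) := by
          rw [add_assoc, ← ENNReal.ofReal_add (half_pos hη).le (half_pos hη).le, add_halves,
            ENNReal.ofReal_add ENNReal.toReal_nonneg hη.le, ENNReal.ofReal_toReal hcost_top.ne]
  exact ⟨w, ⟨hw, kinetic_lt_top_iff.1 (hw_le.trans_lt ENNReal.ofReal_lt_top), hw_fisher⟩,
    ENNReal.toReal_le_of_le_ofReal (add_nonneg ENNReal.toReal_nonneg hη.le) hw_le⟩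

lemma continuousWithinAt_toReal_costSq_zero (hE : IsAdmissibleEnergy E)
    (hne : (regularCurves E x y).Nonempty) :
    ContinuousWithinAt (fun s => (costSq E x y s).toReal) (Ici 0) 0 := by
  refine tendsto_order.2 ⟨fun c hc => ?_, fun c hc => ?_⟩
  · filter_upwards [self_mem_nhdsWithin] with s hs
    exact hc.trans_le (ENNReal.toReal_mono (costSq_lt_top hne hs).ne (costSq_mono E x y hs))
  · obtain ⟨γ, hγ, hγ_le⟩ := exists_mem_regularCurves_kinetic_le hE hne (half_pos (sub_pos.2 hc))
    have hlim : Tendsto (fun s => (energyPair E γ).1 + s * (energyPair E γ).2) (𝓝[≥] 0)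
        (𝓝 (energyPair E γ).1) :=
      (Continuous.tendsto' (by fun_prop) _ _ (by simp)).mono_left nhdsWithin_le_nhds
    filter_upwards [hlim.eventually (gt_mem_nhds (show (energyPair E γ).1 < c by linarith)),
      self_mem_nhdsWithin] with s hs_lt hs
    exact (toReal_costSq_le hγ hs).trans_lt hs_lt

lemma continuousOn_toReal_cost (hE : IsAdmissibleEnergy E) {σ : X → Filter X}
    (hσ : IsWeakConvergence σ) (hslope : SeqLowerSemicontinuous σ (slope E))
    (hne : (regularCurves E x y).Nonempty) :
    ContinuousOn (fun ε => (cost E x y ε).toReal) (Ici 0) := by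
  intro ε hε
  rcases (mem_Ici.1 hε).eq_or_lt with rfl | hε_pos
  · have hzero := continuousWithinAt_toReal_costSq_zero hE hne
    rw [← zero_pow (M₀ := ℝ) two_ne_zero] at hzero
    exact ContinuousWithinAt.comp (f := fun ε : ℝ => ε ^ 2) (t := Ici (0 ^ 2)) hzero
      (continuous_pow 2).continuousWithinAt fun t (ht : 0 ≤ t) =>
        mem_Ici.2 (pow_le_pow_left₀ le_rfl ht 2)
  · obtain ⟨_, -, -, -, hleft⟩ := exists_isMaxOn_fisher_hasDerivWithinAt hσ hslope hne hε_pos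
    obtain ⟨_, -, -, -, hright⟩ := exists_isMinOn_fisher_hasDerivWithinAt hσ hslope hne hε_pos
    exact (continuousAt_iff_continuous_left_right.2
      ⟨hleft.continuousWithinAt, hright.continuousWithinAt⟩).continuousWithinAt

lemma absolutelyContinuousOnInterval_toReal_cost (hE : IsAdmissibleEnergy E) {σ : X → Filter X}
    (hσ : IsWeakConvergence σ) (hslope : SeqLowerSemicontinuous σ (slope E))
    (hne : (regularCurves E x y).Nonempty) {a b : ℝ} (ha : 0 ≤ a) (hab : a ≤ b) :
    AbsolutelyContinuousOnInterval (fun ε => (cost E x y ε).toReal) a b := by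
  have : Nonempty X := ⟨x⟩
  choose! ω _ _ _ hderiv using fun ε (hε : 0 < ε) =>
    exists_isMinOn_fisher_hasDerivWithinAt hσ hslope hne hε
  exact absolutelyContinuousOnInterval_of_right_deriv_nonneg hab
    ((continuousOn_toReal_cost hE hσ hslope hne).mono fun t ht => ha.trans ht.1)
    (fun t ht => (hderiv t (ha.trans_lt ht.1)).mono Ioi_subset_Ici_self)
    fun t ht => mul_nonneg (mul_nonneg zero_le_two (ha.trans ht.1.le)) ENNReal.toReal_nonneg

end Cost

end EntropicCost

theorem proposition5p5_general {X : Type*} [MetricSpace X] {E : X → EReal}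
    (hE : EntropicCost.IsAdmissibleEnergy E) {σ : X → Filter X}
    (hσ : EntropicCost.IsWeakConvergence σ)
    (hslope : EntropicCost.SeqLowerSemicontinuous σ (EntropicCost.slope E)) {x y : X}
    (hxy : ∃ ε : ℝ, 0 < ε ∧ EntropicCost.cost E x y ε < ⊤) :
    (∀ ε : ℝ, 0 ≤ ε → EntropicCost.cost E x y ε < ⊤) ∧
    (∀ a b : ℝ, 0 ≤ a → a ≤ b →
      AbsolutelyContinuousOnInterval (fun ε => (EntropicCost.cost E x y ε).toReal) a b) ∧
    (∀ ε : ℝ, 0 < ε → ∃ ω ∈ EntropicCost.minimizers E x y ε,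
      IsMaxOn (EntropicCost.fisher E) (EntropicCost.minimizers E x y ε) ω ∧
      EntropicCost.fisher E ω < ⊤ ∧
      HasDerivWithinAt (fun ε' => (EntropicCost.cost E x y ε').toReal)
        (2 * ε * (EntropicCost.fisher E ω).toReal) (Iic ε) ε) ∧
    (∀ ε : ℝ, 0 < ε → ∃ ω ∈ EntropicCost.minimizers E x y ε,
      IsMinOn (EntropicCost.fisher E) (EntropicCost.minimizers E x y ε) ω ∧
      EntropicCost.fisher E ω < ⊤ ∧
      HasDerivWithinAt (fun ε' => (EntropicCost.cost E x y ε').toReal)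
        (2 * ε * (EntropicCost.fisher E ω).toReal) (Ici ε) ε) ∧
    (∀ ε : ℝ, 0 < ε → ContinuousWithinAt
      (fun s : ℝ => derivWithin (fun ε' => (EntropicCost.cost E x y ε').toReal) (Iic s) s)
      (Iic ε) ε) ∧
    (∀ ε : ℝ, 0 < ε → ContinuousWithinAt
      (fun s : ℝ => derivWithin (fun ε' => (EntropicCost.cost E x y ε').toReal) (Ici s) s)
      (Ici ε) ε) := by
  obtain ⟨ε₀, hε₀, hlt⟩ := hxy
  have hne := EntropicCost.regularCurves_nonempty hε₀ hlt
  have henv := EntropicCost.isEnvelope_costSq hσ hslope hne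
  exact ⟨fun ε _ => EntropicCost.costSq_lt_top hne (sq_nonneg ε),
    fun a b => EntropicCost.absolutelyContinuousOnInterval_toReal_cost hE hσ hslope hne,
    fun ε => EntropicCost.exists_isMaxOn_fisher_hasDerivWithinAt hσ hslope hne,
    fun ε => EntropicCost.exists_isMinOn_fisher_hasDerivWithinAt hσ hslope hne,
    fun ε => henv.continuousWithinAt_derivWithin_comp_sq_Iic,
    fun ε => henv.continuousWithinAt_derivWithin_comp_sq_Ici⟩

theorem proposition5p5 {X : Type*} [MetricSpace X] [CompleteSpace X]
    [TopologicalSpace.SeparableSpace X] (E : X → EReal)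
    (hE : EntropicCost.IsAdmissibleEnergy E) (hσ : EntropicCost.HasWeakTopology E)
    (x y : X) (hxy : ∃ ε : ℝ, 0 < ε ∧ EntropicCost.IsSolvable E x y ε) :
    -- the cost is finite, so that it may be regarded as a real-valued function of `ε ≥ 0`
    (∀ ε : ℝ, 0 ≤ ε → EntropicCost.cost E x y ε < ⊤) ∧
    -- local absolute continuity on `[0, ∞)`
    (∀ a b : ℝ, 0 ≤ a → a ≤ b →
      AbsolutelyContinuousOnInterval (fun ε => (EntropicCost.cost E x y ε).toReal) a b) ∧
    -- left derivative, the maximum being attained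
    (∀ ε : ℝ, 0 < ε → ∃ ω ∈ EntropicCost.minimizers E x y ε,
      IsMaxOn (EntropicCost.fisher E) (EntropicCost.minimizers E x y ε) ω ∧
      EntropicCost.fisher E ω < ⊤ ∧
      HasDerivWithinAt (fun ε' => (EntropicCost.cost E x y ε').toReal)
        (2 * ε * (EntropicCost.fisher E ω).toReal) (Iic ε) ε) ∧
    -- right derivative, the minimum being attained
    (∀ ε : ℝ, 0 < ε → ∃ ω ∈ EntropicCost.minimizers E x y ε,
      IsMinOn (EntropicCost.fisher E) (EntropicCost.minimizers E x y ε) ω ∧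
      EntropicCost.fisher E ω < ⊤ ∧
      HasDerivWithinAt (fun ε' => (EntropicCost.cost E x y ε').toReal)
        (2 * ε * (EntropicCost.fisher E ω).toReal) (Ici ε) ε) ∧
    -- left continuity of the left derivative, right continuity of the right derivative
    (∀ ε : ℝ, 0 < ε → ContinuousWithinAt
      (fun s : ℝ => derivWithin (fun ε' => (EntropicCost.cost E x y ε').toReal) (Iic s) s)
      (Iic ε) ε) ∧
    (∀ ε : ℝ, 0 < ε → ContinuousWithinAt
      (fun s : ℝ => derivWithin (fun ε' => (EntropicCost.cost E x y ε').toReal) (Ici s) s)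
      (Ici ε) ε) := by
  obtain ⟨τ, -, hcompact, hdist, hslope⟩ := hσ
  obtain ⟨ε, hε, _, -, -, hlt⟩ := hxy
  exact proposition5p5_general hE ⟨fun z => @pure_le_nhds X τ z, hcompact, hdist⟩ hslope
    ⟨ε, hε, hlt⟩
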